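/- **Setting.** Let $\mathcal H,\mathcal H'$ be separable real Hilbert spaces, $X$ a Polish space, $Y$ a separable real Hilbert space, and let $\rho$ be a probability measure on $X\times Y$ with marginal $\nu$ on $X$, conditional distributions $\rho(\cdot|x)$ and $\int\|y\|_Y^2\,d\rho<\infty$. * *Kernel.* $\mathcal H'$ is a reproducing kernel Hilbert space of functions $X\to Y$. With $K_x:Y\to\mathcal H'$ the adjoint of the evaluation $g\mapsto g(x)$, assume that $K_x$ is Hilbert–Schmidt with $\sup_x\|K_x\|_{HS}\le\kappa<\infty$ and that $(x,t)\mapsto\langle K_tv,K_xw\rangle_{\mathcal H'}$ is measurable for all $v,w\in Y$. Let $I_\nu:\mathcal H'\to L^2(X,\nu;Y)$ be the canonical injection, $T_\nu=I_\nu^*I_\nu$, and $\mathcal N(\lambda)=\mathrm{Tr}\big((T_\nu+\lambda I)^{-1}T_\nu\big)$ for $\lambda>0$. * *Hilbert scale.* $L:\mathcal D(L)\subset\mathcal H\to\mathcal H$ is densely defined, self-adjoint and strictly positive, with $\ell_L\|f\|\le\|Lf\|$ on $\mathcal D(L)$ for some $\ell_L>0$; $\|f\|_a=\|L^af\|_{\mathcal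 H}$. * *Model.* $A:\mathcal D(A)\subset\mathcal H\to\mathcal H'$, with $\mathcal D(A)$ convex and closed, is weak-to-weak sequentially continuous; $\hat f\in\mathrm{int}\,\mathcal D(A)$ satisfies $\int y\,d\rho(y|x)=A(\hat f)(x)$ for $\nu$-almost all $x$; and for some $M>0$, $\Sigma\ge0$ the noise $\varepsilon=y-A(\hat f)(x)$ satisfies $\int\big(e^{\|\varepsilon\|/M}-\|\varepsilon\|/M-1\big)d\rho(y|x)\le\Sigma^2/(2M^2)$ for $\nu$-almost all $x$. * *Conditional stability.* $p\ge0$, $s>0$, $\alpha>0$, $d>0$, $\theta\ge0$, and $Q\subset\{f\in\mathcal D(A):\|f-\hat f\|_\theta\le d\}$ is such that $\|f-\hat f\|_{-p}\le\alpha\|I_\nu[A(f)-A(\hat f)]\|_{L^2}^s$ for all $f\in Q$. Moreover $A$ is Lipschitz with constant $\ell_A$ on the intersection of $\mathcal D(A)$ with a ball around $\hat f$ in $\mathcal H$ that contains $Q$. Put $\ell=\ell_A/\ell_L$ and let $\ell_1$ be such that $\|A(f)-A(\hat f)\|_{\mathcal H'}\le\ell_1$ for all $f\in Q$. * *Scheme.*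 $z=((x_i,y_i))_{i=1}^m$ is drawn from $\rho^m$, $m\ge1$, $\bar f\in\mathcal D(A)\cap\mathcal D(L)$, and $f_{z,\lambda}$ denotes any minimizer over $\mathcal D(A)\cap\mathcal D(L)$ of $\frac1m\sum_{i=1}^m\|A(f)(x_i)-y_i\|_Y^2+\lambda\|L(f-\bar f)\|_{\mathcal H}^2$. * *Benchmark smoothness.* $1\le q\le 2+p$ and $q(s-1)<p+s$. For $R\ge0$ put $d(R)=\inf\{\|f-\hat f\|_{\mathcal H}: f-\bar f=L^{-q}w,\ \|w\|_{\mathcal H}\le R\}$; let $\hat f^R$ denote a minimizing element and $d_A(R)=\|I_\nu[A(\hat f^R)-A(\hat f)]\|_{L^2}$. **Corollary (regular case).** Assume the source condition $\hat f-\bar f=L^{-r}v$, $\|v\|_{\mathcal H}\le R^\dagger$, with $r\ge q$, and let $\bar R\ge\|L^{-(r-q)}v\|_{\mathcal H}$, so that $\hat f-\bar f=L^{-q}w$ with $\|w\|_{\mathcal H}\le\bar R$. Then $d(\bar R)=0$, the element $\hat f$ is the unique minimizing element $\hat f^{\bar R}$, and $d_A(\bar R)=0$. Put $$u=\frac{p+q}{2(p+q)-2s(q-1)},\qquad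 \Theta_{\mathcal N,u}(t)=\frac{t^u}{\sqrt{\mathcal N(t)}},$$ and let $\lambda^*=\Theta_{\mathcal N,u}^{-1}(1/\sqrt m)$, i.e. $\lambda^*>0$ and $\Theta_{\mathcal N,u}(\lambda^*)=1/\sqrt m$. Assume $T_\nu\ne0$, $\lambda^*\le1$ and $\mathcal N(\lambda^*)\le m\lambda^*$. Then for every $0<\eta<1$, with probability at least $1-\eta$, every minimizer $f_{z,\lambda^*}$ that belongs to $Q$ satisfies $$\|I_\nu[A(f_{z,\lambda^*})-A(\hat f)]\|_{L^2(X,\nu;Y)}\le\overline C\,(\lambda^*)^u\log\frac4\eta,$$ $$\|f_{z,\lambda^*}-\hat f\|_{\mathcal H}\le\overline C\,(\lambda^*)^{\frac{sq}{2(p+q)-2s(q-1)}}\Big(\log\frac4\eta\Big)^{\max\{1,\frac{p+s}{p+1}\}},$$ where the exponent of the logarithm is $1$ if $s\le1$, and $\frac{2u(s+p)-p}{2(p+1)}=\frac{sq}{2(p+q)-2s(q-1)}$. The constant $\overline C$ depends only on (upper bounds for) $\ell,\ell_1,\kappa,\bar R$, on $p,q,s,M,\Sigma,\alpha$, and on a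 positive lower bound $N_1$ for $\mathcal N(1)$. -/

import Mathlib

open MeasureTheory ProbabilityTheory Filter Topology
open scoped ENNReal NNReal RealInnerProductSpace InnerProductSpace

universe uX uY uH uK

namespace HilbertScale

noncomputable section

/-! ### Traces and Hilbert–Schmidt norms -/

section Trace

variable (E : Type*) [NormedAddCommGroup E] [InnerProductSpace ℝ E] [CompleteSpace E]

/-- The index set of a fixed orthonormal (Hilbert) basis of `E`. -/
def stdIndex : Set E := (exists_hilbertBasis ℝ E).choose

/-- A fixed orthonormal (Hilbert) basis of `E`. -/
def stdBasis : HilbertBasis (stdIndex E) ℝ E := (exists_hilbertBasis ℝ E).choose_spec.choose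

variable {E}

/-- The trace `∑ i, ⟪e i, S (e i)⟫` of an operator `S`. It is used for positive trace-class
operators only, where the series converges and does not depend on the orthonormal basis. -/
def opTrace (S : E →L[ℝ] E) : ℝ := ∑' i, ⟪stdBasis E i, S (stdBasis E i)⟫

/-- The squared Hilbert–Schmidt norm `∑ i, ‖S (e i)‖ ^ 2 = tr (S* S)` in `[0, ∞]`. -/
def hsNormSq {F : Type*} [NormedAddCommGroup F] [InnerProductSpace ℝ F] (S : E →L[ℝ] F) : ℝ≥0∞ :=
  ∑' i, ENNReal.ofReal (‖S (stdBasis E i)‖ ^ 2)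

/-- Bessel-type bound: the adjoint of an operator is bounded by its Hilbert–Schmidt norm. -/
theorem norm_adjoint_apply_le {F : Type*} [NormedAddCommGroup F] [InnerProductSpace ℝ F]
    [CompleteSpace F] (S : E →L[ℝ] F) {c : ℝ} (hc : 0 ≤ c)
    (h : hsNormSq S ≤ ENNReal.ofReal (c ^ 2)) (g : F) :
    ‖S.adjoint g‖ ≤ c * ‖g‖ := by
  have h1 : HasSum (fun i => ⟪S.adjoint g, stdBasis E i⟫ * ⟪stdBasis E i, S.adjoint g⟫)
      ⟪S.adjoint g, S.adjoint g⟫ := (stdBasis E).hasSum_inner_mul_inner _ _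
  have hfin : hsNormSq S ≠ ∞ := ne_top_of_le_ne_top ENNReal.ofReal_ne_top h
  have hsum : Summable (fun i => ‖S (stdBasis E i)‖ ^ 2) := by
    have h' := ENNReal.summable_toReal hfin
    refine h'.congr fun i => ?_
    rw [ENNReal.toReal_ofReal (by positivity)]
  have htot : ∑' i, ‖S (stdBasis E i)‖ ^ 2 ≤ c ^ 2 := by
    have h2 : hsNormSq S = ENNReal.ofReal (∑' i, ‖S (stdBasis E i)‖ ^ 2) :=
      (ENNReal.ofReal_tsum_of_nonneg (fun i => by positivity) hsum).symm
    rw [h2] at h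
    exact (ENNReal.ofReal_le_ofReal_iff (by positivity)).1 h
  have hle : ⟪S.adjoint g, S.adjoint g⟫ ≤ c ^ 2 * ‖g‖ ^ 2 := by
    rw [← h1.tsum_eq]
    calc ∑' i, ⟪S.adjoint g, stdBasis E i⟫ * ⟪stdBasis E i, S.adjoint g⟫
        ≤ ∑' i, ‖S (stdBasis E i)‖ ^ 2 * ‖g‖ ^ 2 := by
          refine h1.summable.tsum_le_tsum (fun i => ?_) (hsum.mul_right _)
          rw [real_inner_comm (S.adjoint g) (stdBasis E i), ContinuousLinearMap.adjoint_inner_left,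
            ← mul_pow, ← sq]
          rw [sq_le_sq, abs_of_nonneg (a := ‖S (stdBasis E i)‖ * ‖g‖) (by positivity)]
          rw [mul_comm]
          exact abs_real_inner_le_norm _ _
      _ = (∑' i, ‖S (stdBasis E i)‖ ^ 2) * ‖g‖ ^ 2 := tsum_mul_right
      _ ≤ c ^ 2 * ‖g‖ ^ 2 := by gcongr
  rw [real_inner_self_eq_norm_sq, ← mul_pow] at hle
  exact (sq_le_sq₀ (norm_nonneg _) (by positivity)).1 hle

end Trace

/-! ### The Hilbert scale generated by an unbounded operator `L` -/

section Scale

variable {H : Type*} [NormedAddCommGroup H] [InnerProductSpace ℝ H] [CompleteSpace H]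

/-- `L` is a self-adjoint (hence densely defined and closed), strictly positive operator with
`c * ‖f‖ ≤ ‖L f‖` on its domain. -/
structure IsScaleGenerator (L : H →ₗ.[ℝ] H) (c : ℝ) : Prop where
  selfAdjoint : IsSelfAdjoint L
  pos : ∀ f : L.domain, (f : H) ≠ 0 → 0 < ⟪L f, (f : H)⟫
  const_pos : 0 < c
  bound : ∀ f : L.domain, c * ‖(f : H)‖ ≤ ‖L f‖

open Classical in
/-- The bounded inverse `L⁻¹ : H → H` of a bijective operator `L : D(L) → H`
(see `invOp_mem_domain`, `apply_invOp`). -/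
def invOp (L : H →ₗ.[ℝ] H) : H →L[ℝ] H :=
  if h : ∃ B : H →L[ℝ] H, ∀ g : H, ∃ hg : B g ∈ L.domain, L ⟨B g, hg⟩ = g then h.choose else 0

/-- A self-adjoint operator that is bounded below has a bounded inverse. -/
theorem exists_invOp {L : H →ₗ.[ℝ] H} {c : ℝ} (hL : IsScaleGenerator L c) :
    ∃ B : H →L[ℝ] H, ∀ g : H, ∃ hg : B g ∈ L.domain, L ⟨B g, hg⟩ = g := by
  have hc := hL.const_pos
  have hdense : Dense (L.domain : Set H) := hL.selfAdjoint.dense_domain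
  have hcl : IsClosed (L.graph : Set (H × H)) := hL.selfAdjoint.isClosed
  -- injectivity
  have hinj : ∀ f : L.domain, L f = 0 → (f : H) = 0 := by
    intro f hf
    have := hL.bound f
    rw [hf, norm_zero] at this
    have h2 : ‖(f : H)‖ ≤ 0 := by
      by_contra hcon
      push Not at hcon
      nlinarith [mul_pos hc hcon]
    exact norm_le_zero_iff.1 h2
  let R : Submodule ℝ H := LinearMap.range L.toFun
  -- the range is closed
  have hRcl : IsClosed (R : Set H) := by
    rw [← isSeqClosed_iff_isClosed]
    intro u y hu huy
    choose x hx using hu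
    have hcau : CauchySeq (fun n => ((x n : L.domain) : H)) := by
      have hcy : CauchySeq u := huy.cauchySeq
      rw [Metric.cauchySeq_iff'] at hcy ⊢
      intro ε hε
      obtain ⟨N, hN⟩ := hcy (c * ε) (by positivity)
      refine ⟨N, fun n hn => ?_⟩
      have h1 := hN n hn
      rw [dist_eq_norm] at h1 ⊢
      have h2 := hL.bound (x n - x N)
      have h3 : L (x n - x N) = u n - u N := by
        rw [LinearPMap.map_sub]
        have e1 : L (x n) = u n := hx n
        have e2 : L (x N) = u N := hx N
        rw [e1, e2]
      rw [h3] at h2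
      have h4 : c * ‖((x n - x N : L.domain) : H)‖ < c * ε := lt_of_le_of_lt h2 h1
      exact lt_of_mul_lt_mul_left h4 hc.le
    obtain ⟨x₀, hx₀⟩ := cauchySeq_tendsto_of_complete hcau
    have hlim : Tendsto (fun n => (((x n : L.domain) : H), u n)) atTop (𝓝 (x₀, y)) :=
      hx₀.prodMk_nhds huy
    have hmem : (x₀, y) ∈ (L.graph : Set (H × H)) := by
      refine hcl.mem_of_tendsto hlim (Eventually.of_forall fun n => ?_)
      have e1 : L (x n) = u n := hx n
      rw [← e1]
      exact L.mem_graph (x n)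
    obtain ⟨z, hz1, hz2⟩ := (LinearPMap.mem_graph_iff L).1 hmem
    exact ⟨z, hz2⟩
  -- the range is dense
  have hRtop : R = ⊤ := by
    have : CompleteSpace R := hRcl.completeSpace_coe
    rw [← Submodule.orthogonal_eq_bot_iff, Submodule.eq_bot_iff]
    intro y hy
    have hy0 : ∀ f : L.domain, ⟪(0 : H), (f : H)⟫ = ⟪y, L f⟫ := by
      intro f
      rw [inner_zero_left]
      have := (Submodule.mem_orthogonal' R y).1 hy (L f) ⟨f, rfl⟩
      exact this.symm
    have hyd : y ∈ (LinearPMap.adjoint L).domain :=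
      LinearPMap.mem_adjoint_domain_of_exists y ⟨0, hy0⟩
    have hyz : LinearPMap.adjoint L ⟨y, hyd⟩ = 0 :=
      LinearPMap.adjoint_apply_eq hdense ⟨y, hyd⟩ hy0
    have hsa : LinearPMap.adjoint L = L := hL.selfAdjoint
    have hmem : (y, (0 : H)) ∈ L.graph := by
      rw [← hsa, ← hyz]
      exact LinearPMap.mem_graph _ ⟨y, hyd⟩
    obtain ⟨z, hz1, hz2⟩ := (LinearPMap.mem_graph_iff L).1 hmem
    have hz3 : (z : H) = y := hz1
    rw [← hz3]
    exact hinj z hz2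
  -- the inverse
  have hsurj : ∀ g : H, ∃ f : L.domain, L f = g := by
    intro g
    have : g ∈ R := by rw [hRtop]; trivial
    obtain ⟨f, hf⟩ := this
    exact ⟨f, hf⟩
  choose s hs using hsurj
  have huniq : ∀ f f' : L.domain, L f = L f' → (f : H) = f' := by
    intro f f' hff
    have := hinj (f - f') (by rw [LinearPMap.map_sub, hff, sub_self])
    rw [Submodule.coe_sub] at this
    exact sub_eq_zero.1 this
  let Blin : H →ₗ[ℝ] H :=
    { toFun := fun g => (s g : H)
      map_add' := fun g g' => by
        rw [← Submodule.coe_add]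
        exact huniq _ _ (by rw [LinearPMap.map_add, hs, hs, hs])
      map_smul' := fun a g => by
        rw [RingHom.id_apply, ← Submodule.coe_smul]
        exact huniq _ _ (by rw [LinearPMap.map_smul, hs, hs]) }
  refine ⟨Blin.mkContinuous c⁻¹ fun g => ?_, fun g => ⟨(s g).2, ?_⟩⟩
  · have h1 := hL.bound (s g)
    rw [hs] at h1
    change ‖(s g : H)‖ ≤ c⁻¹ * ‖g‖
    rw [inv_mul_eq_div, le_div_iff₀ hc, mul_comm]
    exact h1
  · exact hs g

theorem invOp_mem_domain {L : H →ₗ.[ℝ] H} {c : ℝ} (hL : IsScaleGenerator L c) (g : H) :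
    invOp L g ∈ L.domain := by
  have h := exists_invOp hL
  rw [invOp, dif_pos h]
  exact (h.choose_spec g).1

theorem apply_invOp {L : H →ₗ.[ℝ] H} {c : ℝ} (hL : IsScaleGenerator L c) (g : H) :
    L ⟨invOp L g, invOp_mem_domain hL g⟩ = g := by
  have h := exists_invOp hL
  have key : ∀ (B : H →L[ℝ] H) (hB : B g ∈ L.domain), B = h.choose → L ⟨B g, hB⟩ = g := by
    rintro B hB rfl
    exact (h.choose_spec g).2
  exact key _ _ (by rw [invOp, dif_pos h])

/-- `S = B ^ a` in the sense of the continuous functional calculus of the bounded, self-adjoint,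
nonnegative operator `B`, whose spectrum lies in `[0, ‖B‖]`: `S` is the limit in operator norm of
`P n (B)` for polynomials `P n` that converge to `t ↦ t ^ a` uniformly on `[0, ‖B‖]`. -/
def IsOpPower (B : H →L[ℝ] H) (a : ℝ) (S : H →L[ℝ] H) : Prop :=
  ∃ P : ℕ → Polynomial ℝ,
    TendstoUniformlyOn (fun n t => (P n).eval t) (fun t => t ^ a) atTop (Set.Icc 0 ‖B‖) ∧
    Tendsto (fun n => Polynomial.aeval B (P n)) atTop (𝓝 S)

open Classical in
/-- The power `B ^ a`, `0 ≤ a`, of a bounded, self-adjoint, nonnegative operator `B`. -/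
def opPower (B : H →L[ℝ] H) (a : ℝ) : H →L[ℝ] H :=
  if h : ∃ S, IsOpPower B a S then h.choose else 0

/-- The bounded operator `L ^ (-a) = (L⁻¹) ^ a`, for `0 ≤ a`. -/
def negPower (L : H →ₗ.[ℝ] H) (a : ℝ) : H →L[ℝ] H := opPower (invOp L) a

/-- The norm `‖f‖_{-a} = ‖L ^ (-a) f‖` of the Hilbert scale, for `0 ≤ a`. -/
def negNorm (L : H →ₗ.[ℝ] H) (a : ℝ) (f : H) : ℝ := ‖negPower L a f‖

/-- For `0 ≤ a`: the ball `{f | f - center ∈ D(L ^ a), ‖L ^ a (f - center)‖ ≤ radius}`;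
here `D(L ^ a)` is the range of `L ^ (-a)` and `L ^ a` its inverse there. -/
def scaleBall (L : H →ₗ.[ℝ] H) (a : ℝ) (center : H) (radius : ℝ) : Set H :=
  {f | ∃ w : H, f - center = negPower L a w ∧ ‖w‖ ≤ radius}

/-- The admissible elements of the benchmark source condition:
`f - fbar = L ^ (-q) v` with `‖v‖ ≤ R`. -/
def benchmarkSet (L : H →ₗ.[ℝ] H) (q : ℝ) (fbar : H) (R : ℝ) : Set H :=
  {f | ∃ v : H, f - fbar = negPower L q v ∧ ‖v‖ ≤ R}

/-- The distance function `d(R)` of the approximate source condition. -/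
def distFun (L : H →ₗ.[ℝ] H) (q : ℝ) (fbar fhat : H) (R : ℝ) : ℝ :=
  sInf ((fun f => ‖f - fhat‖) '' benchmarkSet L q fbar R)

/-- `f` is a minimizing element of the problem that defines `d(R)`. -/
def IsDistMinimizer (L : H →ₗ.[ℝ] H) (q : ℝ) (fbar fhat : H) (R : ℝ) (f : H) : Prop :=
  f ∈ benchmarkSet L q fbar R ∧ ‖f - fhat‖ = distFun L q fbar fhat R

end Scale

/-! ### The reproducing kernel Hilbert space, the covariance operator, the effective dimension -/

section RKHS

variable {X : Type*} [MeasurableSpace X]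
  {Y : Type*} [NormedAddCommGroup Y] [InnerProductSpace ℝ Y] [CompleteSpace Y]
  {H' : Type*} [NormedAddCommGroup H'] [InnerProductSpace ℝ H'] [CompleteSpace H']
  [RKHS ℝ H' X Y]

variable (H') in
/-- The kernel operators `K_x : Y → H'` are Hilbert–Schmidt with `‖K_x‖_HS ≤ κ` for all `x`, and
`(x, t) ↦ ⟪K_t v, K_x w⟫` is measurable for all `v`, `w`. -/
structure IsBoundedMeasurableKernel (κ : ℝ) : Prop where
  nonneg : 0 ≤ κ
  hs_le : ∀ x : X, hsNormSq (RKHS.kerFun H' x) ≤ ENNReal.ofReal (κ ^ 2)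
  meas : ∀ v w : Y, Measurable
    (fun z : X × X => (⟪RKHS.kerFun H' z.2 v, RKHS.kerFun H' z.1 w⟫ : ℝ))

variable {κ : ℝ}

theorem norm_apply_le (hK : IsBoundedMeasurableKernel H' κ) (g : H') (x : X) :
    ‖g x‖ ≤ κ * ‖g‖ := by
  rw [← RKHS.adjoint_kerFun x g]
  exact norm_adjoint_apply_le _ hK.nonneg (hK.hs_le x) g

theorem measurable_inner_apply (hK : IsBoundedMeasurableKernel H' κ) (w : Y) (g : H') :
    Measurable (fun x => ⟪g x, w⟫) := by
  let M : Submodule ℝ H' :=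
    { carrier := {g | Measurable (fun x => ⟪g, RKHS.kerFun H' x w⟫)}
      add_mem' := fun {a b} ha hb => by
        change Measurable (fun x => ⟪a + b, RKHS.kerFun H' x w⟫)
        simp only [inner_add_left]
        exact Measurable.add ha hb
      zero_mem' := by
        change Measurable (fun x => ⟪(0 : H'), RKHS.kerFun H' x w⟫)
        simp only [inner_zero_left]
        exact measurable_const
      smul_mem' := fun c a ha => by
        change Measurable (fun x => ⟪c • a, RKHS.kerFun H' x w⟫)
        simp only [real_inner_smul_left]
        exact Measurable.const_mul ha c }
  have hMcl : IsClosed (M : Set H') := by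
    rw [← isSeqClosed_iff_isClosed]
    intro u a hu hua
    refine measurable_of_tendsto_metrizable (f := fun n x => ⟪u n, RKHS.kerFun H' x w⟫) hu ?_
    rw [tendsto_pi_nhds]
    intro x
    exact hua.inner tendsto_const_nhds
  have hspan : Submodule.span ℝ {RKHS.kerFun H' x v | (x : X) (v : Y)} ≤ M := by
    rw [Submodule.span_le]
    rintro _ ⟨t, v, rfl⟩
    change Measurable (fun x => ⟪RKHS.kerFun H' t v, RKHS.kerFun H' x w⟫)
    have hpair : Measurable (fun x : X => (x, t)) := measurable_id.prodMk measurable_const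
    have h1 := hK.meas v w
    have h2 := h1.comp hpair
    simp only [Function.comp_def] at h2
    exact h2
  have htop : (⊤ : Submodule ℝ H') ≤ M := by
    exact (RKHS.kerFun_dense H').ge.trans
      (Submodule.topologicalClosure_minimal _ hspan hMcl)
  have hg : g ∈ M := htop trivial
  have : (fun x => ⟪g x, w⟫) = fun x => ⟪g, RKHS.kerFun H' x w⟫ := by
    funext x
    rw [RKHS.inner_kerFun]
  rw [this]
  exact hg

variable [TopologicalSpace.SeparableSpace Y] [MeasurableSpace Y] [BorelSpace Y]

theorem measurable_apply (hK : IsBoundedMeasurableKernel H' κ) (g : H') :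
    Measurable (fun x => g x) := by
  have : SecondCountableTopology Y := UniformSpace.secondCountable_of_separable Y
  let φ : Y → ℕ → ℝ := fun y n => ⟪y, TopologicalSpace.denseSeq Y n⟫
  have hφc : Continuous φ := by
    refine continuous_pi fun n => ?_
    exact continuous_id.inner continuous_const
  have hφi : Function.Injective φ := by
    intro y y' h
    have hd : DenseRange (TopologicalSpace.denseSeq Y) := TopologicalSpace.denseRange_denseSeq Y
    have heq : (fun v : Y => (⟪y, v⟫ : ℝ)) = fun v => ⟪y', v⟫ :=
      hd.equalizer (continuous_const.inner continuous_id) (continuous_const.inner continuous_id)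
        (by funext n; exact congrFun h n)
    exact ext_inner_right ℝ fun v => congrFun heq v
  have hemb : MeasurableEmbedding φ := hφc.measurableEmbedding hφi
  rw [← hemb.measurable_comp_iff]
  refine measurable_pi_lambda _ fun n => ?_
  exact measurable_inner_apply hK _ g

theorem memLp_apply (hK : IsBoundedMeasurableKernel H' κ) (ν : Measure X) [IsFiniteMeasure ν]
    (g : H') : MemLp (fun x => g x) 2 ν := by
  have : SecondCountableTopology Y := UniformSpace.secondCountable_of_separable Y
  exact MemLp.of_bound (measurable_apply hK g).aestronglyMeasurable (κ * ‖g‖)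
    (Eventually.of_forall fun x => norm_apply_le hK g x)

/-- The canonical injection `I_ν : H' → L²(X, ν; Y)`, `g ↦ g`. -/
def embL2 (hK : IsBoundedMeasurableKernel H' κ) (ν : Measure X) [IsProbabilityMeasure ν] :
    H' →L[ℝ] Lp Y 2 ν :=
  LinearMap.mkContinuous
    { toFun := fun g => (memLp_apply hK ν g).toLp
      map_add' := fun g g' => by
        rw [← MemLp.toLp_add]
        congr 1
        exact RKHS.coe_add g g'
      map_smul' := fun c g => by
        rw [RingHom.id_apply, ← MemLp.toLp_const_smul]
        congr 1
        exact RKHS.coe_smul g c } κ (fun g => by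
      change ‖(memLp_apply hK ν g).toLp‖ ≤ κ * ‖g‖
      have h0 : 0 ≤ κ * ‖g‖ := mul_nonneg hK.nonneg (norm_nonneg g)
      have h := Lp.norm_le_of_ae_bound (f := (memLp_apply hK ν g).toLp) h0 (by
        filter_upwards [(memLp_apply hK ν g).coeFn_toLp] with x hx
        rw [hx]
        exact norm_apply_le hK g x)
      have h1 : measureUnivNNReal ν = 1 := by simp [measureUnivNNReal]
      rw [h1] at h
      simpa using h)

/-- The covariance operator `T_ν = I_ν* I_ν`. -/
def covOp (hK : IsBoundedMeasurableKernel H' κ) (ν : Measure X) [IsProbabilityMeasure ν] :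
    H' →L[ℝ] H' :=
  (embL2 hK ν).adjoint ∘L embL2 hK ν

/-- The effective dimension `N(t) = Tr ((T_ν + t I)⁻¹ T_ν)`, for `t > 0`. -/
def effDim (hK : IsBoundedMeasurableKernel H' κ) (ν : Measure X) [IsProbabilityMeasure ν]
    (t : ℝ) : ℝ :=
  opTrace (Ring.inverse (covOp hK ν + t • (1 : H' →L[ℝ] H')) * covOp hK ν)

/-- The function `Θ_{N,u}(t) = t ^ u / √N(t)`, for `t > 0`. -/
def thetaFun (hK : IsBoundedMeasurableKernel H' κ) (ν : Measure X) [IsProbabilityMeasure ν]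
    (u t : ℝ) : ℝ :=
  t ^ u / √(effDim hK ν t)

end RKHS

/-! ### The statistical model and the Tikhonov scheme -/

section Model

variable {X : Type*} [MeasurableSpace X]
  {Y : Type*} [NormedAddCommGroup Y] [InnerProductSpace ℝ Y] [CompleteSpace Y]
  [TopologicalSpace.SeparableSpace Y] [MeasurableSpace Y] [BorelSpace Y]
  {H : Type*} [NormedAddCommGroup H] [InnerProductSpace ℝ H] [CompleteSpace H]
  {H' : Type*} [NormedAddCommGroup H'] [InnerProductSpace ℝ H'] [CompleteSpace H']
  [RKHS ℝ H' X Y]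

/-- The conditional distribution `ρ(· | x)` of `y` given `x`. -/
def condLaw (ρ : Measure (X × Y)) [IsFiniteMeasure ρ] (x : X) : Measure Y :=
  haveI : SecondCountableTopology Y := UniformSpace.secondCountable_of_separable Y
  ρ.condKernel x

/-- `fhat` is a true solution: an interior point of the domain `D` of `A` with
`∫ y dρ(y | x) = A(fhat)(x)` for `ν`-almost all `x`, where `∫ ‖y‖ ^ 2 dρ < ∞`. -/
structure IsTrueSolution (ρ : Measure (X × Y)) [IsFiniteMeasure ρ] (D : Set H) (A : H → H')
    (fhat : H) : Prop where
  secondMoment : MemLp (fun z : X × Y => z.2) 2 ρ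
  mem_interior : fhat ∈ interior D
  condMean : ∀ᵐ x ∂ρ.fst, ∫ y, y ∂(condLaw ρ x) = A fhat x

/-- The Bernstein-type noise condition with constants `M`, `Sig` for `ε = y - A(fhat)(x)`. -/
def NoiseCondition (ρ : Measure (X × Y)) [IsFiniteMeasure ρ] (A : H → H') (fhat : H)
    (M Sig : ℝ) : Prop :=
  ∀ᵐ x ∂ρ.fst,
    ∫⁻ y, ENNReal.ofReal (Real.exp (‖y - A fhat x‖ / M) - ‖y - A fhat x‖ / M - 1) ∂(condLaw ρ x)
      ≤ ENNReal.ofReal (Sig ^ 2 / (2 * M ^ 2))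

/-- `A : D → H'` is weak-to-weak sequentially continuous. -/
def WeakSeqContinuousOn (A : H → H') (D : Set H) : Prop :=
  ∀ (f : ℕ → H) (f₀ : H), (∀ n, f n ∈ D) → f₀ ∈ D →
    (∀ h : H, Tendsto (fun n => ⟪f n, h⟫) atTop (𝓝 ⟪f₀, h⟫)) →
    ∀ g : H', Tendsto (fun n => ⟪A (f n), g⟫) atTop (𝓝 ⟪A f₀, g⟫)

/-- The Tikhonov functional
`(1 / m) ∑ i, ‖A(f)(x i) - y i‖ ^ 2 + t * ‖L (f - fbar)‖ ^ 2` for `f, fbar ∈ D(L)`. -/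
def tikhonov (L : H →ₗ.[ℝ] H) (A : H → H') (fbar : L.domain) {m : ℕ} (z : Fin m → X × Y)
    (t : ℝ) (f : L.domain) : ℝ :=
  (1 / (m : ℝ)) * ∑ i, ‖A (f : H) (z i).1 - (z i).2‖ ^ 2 + t * ‖L (f - fbar)‖ ^ 2

/-- `f` is a global minimizer of the Tikhonov functional over `D ∩ D(L)`. -/
def IsTikhonovMinimizer (L : H →ₗ.[ℝ] H) (D : Set H) (A : H → H') (fbar : L.domain) {m : ℕ}
    (z : Fin m → X × Y) (t : ℝ) (f : L.domain) : Prop :=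
  (f : H) ∈ D ∧ ∀ g : L.domain, (g : H) ∈ D →
    tikhonov L A fbar z t f ≤ tikhonov L A fbar z t g

end Model

end

end HilbertScale

/-! Comparing the Tikhonov functional at a minimizer `f` and at the true solution gives, with `g = A
f - A fhat` and `x = L (f - fhat)`, the bound `⟪T' g, g⟫ + t ‖x‖ ^ 2 ≤ 2 ⟪g, ζ⟫ - 2 t ⟪x, L (fhat -
fbar)⟫`. Here `T'` is the empirical covariance and `ζ` is the average of the vectors `K_{x i} ε i`
(`basic_inequality`). The randomness enters only through `ζ` and `T' - T_ν`.

Both are measured after applying `(T_ν + t I) ^ (-1/2)`. Pairing with `g` then costs `√(⟪T_ν g, g⟫ +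
t ‖g‖ ^ 2)`. By the Lipschitz bound this is at most `(1 + ℓ) Z`, where `Z ^ 2 = b ^ 2 + t ‖x‖ ^ 2`
and `b` is the L² norm of `g` (`abs_inner_le_whitening`, `energy_le_of_deviation`). A Bernstein
inequality in Hilbert space (`measure_norm_sum_gt_le`) controls the whitened deviations. Their
variance is governed by the effective dimension, since the squared Hilbert–Schmidt norm of `(T_ν + t
I) ^ (-1/2) K_x` integrates to `N(t)` (`lintegral_hsNormSq_whitenedKer_eq`). At the chosen parameter
`√(N(t) / m) = t ^ u`, so both deviations are of order `t ^ u log (4 / η)` (`deviation_le`). As `g`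
depends on the sample, the covariance bound must hold for all `g` on one event. It is therefore
proved in Hilbert–Schmidt norm (`exists_covariance_event`).

For the remaining term, `L (fhat - fbar) = L ^ (-(q - 1)) w`. Interpolation in the scale together
with conditional stability bounds it by a power of `t` times `Z ^ k`, with `k < 2` precisely because
`q (s - 1) < p + s`. Solving the resulting inequality for `Z` produces the exponent `u`
(`sqrt_energy_le`). Interpolating `L⁻¹ x = f - fhat` between `L ^ (-(p + 1)) x` and `x` turns the
bound on `Z` into the bound in `H` (`interpolated_error_le`). -/

namespace HilbertScale

/-! ### Fractional powers of positive operators and the interpolation inequality. -/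

section OperatorPowers

variable {H : Type*} [NormedAddCommGroup H] [InnerProductSpace ℝ H]

/-- Gauss-type quadrature for a positive operator: on polynomials of bounded degree, the quadratic
functional `p ↦ ‖p(B) f‖ ^ 2` is a finite sum over nodes in `[0, ‖B‖]`. -/
theorem exists_quadrature {B : H →L[ℝ] H} (hB : B.IsPositive) (f : H) (N : ℕ) :
    ∃ (n : ℕ) (w μ : Fin n → ℝ), (∀ k, 0 ≤ w k) ∧ (∀ k, μ k ∈ Set.Icc 0 ‖B‖) ∧
      ∀ P : Polynomial ℝ, P.natDegree ≤ N →
        ‖Polynomial.aeval B P f‖ ^ 2 = ∑ k, w k * (P.eval (μ k)) ^ 2 := by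
  -- The nodes are the eigenvalues of the compression of `B` to the Krylov space of `f`, and the
  -- weights are the squared coordinates of `f` in its eigenbasis.
  let V : Submodule ℝ H := Submodule.span ℝ (Set.range fun k : Fin (N + 1) => (B ^ (k : ℕ)) f)
  have hfin : FiniteDimensional ℝ V := FiniteDimensional.span_of_finite ℝ (Set.finite_range _)
  have hmem : ∀ j ≤ N, (B ^ j) f ∈ V := fun j hj =>
    Submodule.subset_span ⟨⟨j, by omega⟩, rfl⟩
  let T : V →ₗ[ℝ] V :=
    (V.orthogonalProjectionOnto : H →ₗ[ℝ] V) ∘ₗ (B : H →ₗ[ℝ] H) ∘ₗ V.subtype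
  have hTin : ∀ v w : V, ⟪T v, w⟫ = ⟪B v, (w : H)⟫ := fun v w =>
    Submodule.inner_orthogonalProjectionOnto_eq_of_mem_right w (B v)
  have hT : T.IsSymmetric := fun v w => by
    rw [hTin, real_inner_comm (T w) v, hTin, hB.inner_left_eq_inner_right, real_inner_comm]
  let b := hT.eigenvectorBasis rfl
  let μ := hT.eigenvalues rfl
  have hb : ∀ k, ‖b k‖ = 1 := fun k => b.orthonormal.1 k
  have hTb : ∀ k, T (b k) = μ k • b k := fun k => hT.apply_eigenvectorBasis rfl k
  have hμ : ∀ k, μ k = ⟪B (b k), (b k : H)⟫ := fun k => by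
    rw [← hTin, hTb, real_inner_smul_left, real_inner_self_eq_norm_sq, hb]; simp
  -- Compression loses nothing here. One factor `B` is moved onto `b k`, and it is then paired with
  -- `B ^ j f`, which still lies in `V`.
  have hpow : ∀ k, ∀ j ≤ N, ⟪(b k : H), (B ^ j) f⟫ = μ k ^ j * ⟪(b k : H), f⟫ := by
    intro k j
    induction j with
    | zero => intro _; simp
    | succ j ih =>
      intro hj
      have h1 : ⟪(b k : H), (B ^ (j + 1)) f⟫ = ⟪B (b k), (B ^ j) f⟫ := by
        rw [pow_succ', hB.inner_left_eq_inner_right]; rfl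
      have h2 : ⟪B (b k), (B ^ j) f⟫ = ⟪T (b k), (⟨(B ^ j) f, hmem j (by omega)⟩ : V)⟫ :=
        (hTin (b k) ⟨(B ^ j) f, hmem j (by omega)⟩).symm
      rw [h1, h2, hTb, real_inner_smul_left, Submodule.coe_inner]
      rw [ih (by omega)]; ring
  refine ⟨_, fun k => ⟪(b k : H), f⟫ ^ 2, μ, fun k => sq_nonneg _, fun k => ⟨?_, ?_⟩, ?_⟩
  · rw [hμ]; exact hB.inner_nonneg_left _
  · rw [hμ]
    refine (real_inner_le_norm _ _).trans ?_
    have h1 := B.le_opNorm (b k : H)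
    have h2 : ‖(b k : H)‖ = 1 := hb k
    rw [h2] at h1 ⊢
    linarith
  · intro P hP
    have hexp : Polynomial.aeval B P f = ∑ j ∈ Finset.range (P.natDegree + 1),
        P.coeff j • (B ^ j) f := by
      rw [Polynomial.aeval_eq_sum_range]
      simp
    have hV : Polynomial.aeval B P f ∈ V := by
      rw [hexp]
      refine V.sum_mem fun j hj => V.smul_mem _ (hmem j ?_)
      have := Finset.mem_range.1 hj
      omega
    have hcoef : ∀ k, ⟪(b k : H), Polynomial.aeval B P f⟫ = P.eval (μ k) * ⟪(b k : H), f⟫ := by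
      intro k
      rw [hexp, inner_sum, Polynomial.eval_eq_sum_range, Finset.sum_mul]
      refine Finset.sum_congr rfl fun j hj => ?_
      have := Finset.mem_range.1 hj
      rw [real_inner_smul_right, hpow k j (by omega)]; ring
    have hsum := b.sum_sq_norm_inner_right (⟨Polynomial.aeval B P f, hV⟩ : V)
    have hn : ‖(⟨Polynomial.aeval B P f, hV⟩ : V)‖ = ‖Polynomial.aeval B P f‖ := rfl
    rw [← hn, ← hsum]
    refine Finset.sum_congr rfl fun k _ => ?_
    have h3 : ⟪b k, (⟨Polynomial.aeval B P f, hV⟩ : V)⟫ = P.eval (μ k) * ⟪(b k : H), f⟫ := hcoef k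
    rw [h3, Real.norm_eq_abs, sq_abs]; ring

/-- The quadrature stands in for the spectral theorem: each `‖P(B) f‖ ^ 2` is a weighted sum of
squares of values of `P` on `[0, ‖B‖]`, with total weight `‖f‖ ^ 2`. Uniform approximation of
functions thus becomes approximation in operator norm. -/
theorem norm_aeval_le {B : H →L[ℝ] H} (hB : B.IsPositive) (P : Polynomial ℝ) {c : ℝ} (hc : 0 ≤ c)
    (h : ∀ t ∈ Set.Icc 0 ‖B‖, |P.eval t| ≤ c) : ‖Polynomial.aeval B P‖ ≤ c := by
  refine ContinuousLinearMap.opNorm_le_bound _ hc fun f => ?_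
  obtain ⟨n, w, μ, hw, hμ, hq⟩ := exists_quadrature hB f P.natDegree
  have h1 := hq P le_rfl
  have h2 := hq 1 (by simp)
  simp only [map_one, one_apply_eq_self, Polynomial.eval_one, one_pow, mul_one] at h2
  refine (sq_le_sq₀ (norm_nonneg _) (by positivity)).1 ?_
  rw [h1, mul_pow, h2, Finset.mul_sum]
  refine Finset.sum_le_sum fun k _ => ?_
  rw [mul_comm]
  exact mul_le_mul_of_nonneg_right (sq_le_sq.2 (by rw [abs_of_nonneg hc]; exact h _ (hμ k))) (hw k)

/-- Uniform convergence passes to products only when the limits are bounded, which `t ^ a` is on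
`[0, ‖B‖]`. -/
theorem tendstoUniformlyOn_mul_of_bounded {α : Type*} {s : Set α} {F G : ℕ → α → ℝ} {f g : α → ℝ}
    {c : ℝ} (hF : TendstoUniformlyOn F f atTop s) (hG : TendstoUniformlyOn G g atTop s)
    (hf : ∀ x ∈ s, |f x| ≤ c) (hg : ∀ x ∈ s, |g x| ≤ c) :
    TendstoUniformlyOn (fun n x => F n x * G n x) (fun x => f x * g x) atTop s := by
  rw [Metric.tendstoUniformlyOn_iff] at *
  intro ε hε
  set C := |c| + 1 with hC
  have hC0 : 0 < C := by positivity
  set δ := min 1 (ε / (4 * C)) with hδ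
  have hδ0 : 0 < δ := by positivity
  have hδ1 : δ ≤ 1 := min_le_left _ _
  have hδ2 : δ * (4 * C) ≤ ε := by
    rw [← le_div_iff₀ (by positivity)]; exact min_le_right _ _
  filter_upwards [hF δ hδ0, hG δ hδ0] with n h1 h2 x hx
  have e1 := h1 x hx
  have e2 := h2 x hx
  rw [Real.dist_eq] at *
  have e3 : |f x| ≤ C := (hf x hx).trans ((le_abs_self c).trans (by linarith))
  have e4 : |g x| ≤ C := (hg x hx).trans ((le_abs_self c).trans (by linarith))
  have e5 : |G n x| ≤ C + 1 := by
    calc |G n x| = |g x - (g x - G n x)| := by ring_nf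
      _ ≤ |g x| + |g x - G n x| := abs_sub _ _
      _ ≤ C + 1 := by linarith
  calc |f x * g x - F n x * G n x| = |f x * (g x - G n x) + (f x - F n x) * G n x| := by ring_nf
    _ ≤ |f x| * |g x - G n x| + |f x - F n x| * |G n x| := by
      rw [← abs_mul, ← abs_mul]; exact abs_add_le _ _
    _ ≤ C * δ + δ * (C + 1) := by gcongr
    _ < 4 * (C * δ) := by nlinarith [mul_pos hC0 hδ0, abs_nonneg c]
    _ ≤ ε := by linarith

theorem abs_rpow_le_of_mem {b a t : ℝ} (ha : 0 ≤ a) (ht : t ∈ Set.Icc 0 b) : |t ^ a| ≤ b ^ a := by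
  rw [abs_of_nonneg (Real.rpow_nonneg ht.1 _)]
  exact Real.rpow_le_rpow ht.1 ht.2 ha

theorem IsOpPower.unique {B : H →L[ℝ] H} (hB : B.IsPositive) {a : ℝ} {S S' : H →L[ℝ] H}
    (h : IsOpPower B a S) (h' : IsOpPower B a S') : S = S' := by
  obtain ⟨P, hP, hPS⟩ := h
  obtain ⟨Q, hQ, hQS⟩ := h'
  have hlim : Tendsto (fun n => Polynomial.aeval B (P n) - Polynomial.aeval B (Q n)) atTop (𝓝 0) := by
    rw [Metric.tendsto_atTop']
    intro ε hε
    rw [Metric.tendstoUniformlyOn_iff] at hP hQ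
    obtain ⟨N, hN⟩ := eventually_atTop.1
      ((hP (ε / 4) (by positivity)).and (hQ (ε / 4) (by positivity)))
    refine ⟨N, fun n hn => ?_⟩
    rw [dist_zero_right, ← map_sub]
    refine (norm_aeval_le hB _ (c := ε / 2) (by positivity) fun t ht => ?_).trans_lt (by linarith)
    have e1 := (hN n hn.le).1 t ht
    have e2 := (hN n hn.le).2 t ht
    rw [Real.dist_eq] at e1 e2
    rw [Polynomial.eval_sub]
    rw [abs_lt] at e1 e2
    rw [abs_le]; constructor <;> linarith
  exact sub_eq_zero.1 (tendsto_nhds_unique (hPS.sub hQS) hlim)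

variable [CompleteSpace H]

theorem exists_isOpPower {B : H →L[ℝ] H} (hB : B.IsPositive) {a : ℝ} (ha : 0 ≤ a) :
    ∃ S, IsOpPower B a S := by
  have hcont : ContinuousOn (fun t : ℝ => t ^ a) (Set.Icc 0 ‖B‖) :=
    (Real.continuous_rpow_const ha).continuousOn
  choose P hP using fun n : ℕ => exists_polynomial_near_of_continuousOn 0 ‖B‖ _ hcont
    (1 / ((n : ℝ) + 1)) (by positivity)
  have hlim : Tendsto (fun n : ℕ => 1 / ((n : ℝ) + 1)) atTop (𝓝 0) :=
    tendsto_one_div_add_atTop_nhds_zero_nat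
  have hunif : TendstoUniformlyOn (fun n t => (P n).eval t) (fun t => t ^ a) atTop
      (Set.Icc 0 ‖B‖) := by
    rw [Metric.tendstoUniformlyOn_iff]
    intro ε hε
    filter_upwards [hlim.eventually (gt_mem_nhds hε)] with n hn t ht
    rw [dist_comm, Real.dist_eq]
    exact (hP n t ht).trans hn
  have hcau : CauchySeq fun n => Polynomial.aeval B (P n) := by
    rw [Metric.cauchySeq_iff]
    intro ε hε
    obtain ⟨N, hN⟩ := eventually_atTop.1
      ((Metric.tendstoUniformlyOn_iff.1 hunif) (ε / 4) (by positivity))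
    refine ⟨N, fun m hm n hn => ?_⟩
    rw [dist_eq_norm, ← map_sub]
    refine (norm_aeval_le hB _ (c := ε / 2) (by positivity) fun t ht => ?_).trans_lt (by linarith)
    have e1 := hN m hm t ht
    have e2 := hN n hn t ht
    rw [Real.dist_eq] at e1 e2
    rw [Polynomial.eval_sub]
    rw [abs_lt] at e1 e2
    rw [abs_le]; constructor <;> linarith
  obtain ⟨S, hS⟩ := cauchySeq_tendsto_of_complete hcau
  exact ⟨S, P, hunif, hS⟩

theorem isOpPower_opPower {B : H →L[ℝ] H} (hB : B.IsPositive) {a : ℝ} (ha : 0 ≤ a) :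
    IsOpPower B a (opPower B a) := by
  have h := exists_isOpPower hB ha
  rw [opPower, dif_pos h]
  exact h.choose_spec

/-- Uniqueness makes the choice in `opPower` harmless: an identity between powers is proved by
exhibiting approximating polynomials. -/
theorem IsOpPower.eq_opPower {B : H →L[ℝ] H} (hB : B.IsPositive) {a : ℝ} (ha : 0 ≤ a)
    {S : H →L[ℝ] H} (h : IsOpPower B a S) : opPower B a = S :=
  (isOpPower_opPower hB ha).unique hB h

theorem opPower_zero {B : H →L[ℝ] H} (hB : B.IsPositive) : opPower B 0 = 1 := by
  refine IsOpPower.eq_opPower hB le_rfl ⟨fun _ => 1, ?_, ?_⟩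
  · simp only [Polynomial.eval_one, Real.rpow_zero]
    exact fun u hu => Eventually.of_forall fun _ _ _ => refl_mem_uniformity hu
  · simp

theorem opPower_one {B : H →L[ℝ] H} (hB : B.IsPositive) : opPower B 1 = B := by
  refine IsOpPower.eq_opPower hB zero_le_one ⟨fun _ => Polynomial.X, ?_, ?_⟩
  · simp only [Polynomial.eval_X, Real.rpow_one]
    exact fun u hu => Eventually.of_forall fun _ _ _ => refl_mem_uniformity hu
  · simp

theorem opPower_add {B : H →L[ℝ] H} (hB : B.IsPositive) {a b : ℝ} (ha : 0 ≤ a) (hb : 0 ≤ b) :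
    opPower B (a + b) = opPower B a * opPower B b := by
  obtain ⟨P, hP, hPS⟩ := isOpPower_opPower hB ha
  obtain ⟨Q, hQ, hQS⟩ := isOpPower_opPower hB hb
  refine IsOpPower.eq_opPower hB (add_nonneg ha hb) ⟨fun n => P n * Q n, ?_, ?_⟩
  · have h := tendstoUniformlyOn_mul_of_bounded hP hQ (c := max (‖B‖ ^ a) (‖B‖ ^ b))
      (fun t ht => (abs_rpow_le_of_mem ha ht).trans (le_max_left _ _))
      (fun t ht => (abs_rpow_le_of_mem hb ht).trans (le_max_right _ _))
    refine (h.congr_right fun t ht => ?_).congr (Eventually.of_forall fun n t _ => ?_)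
    · exact (Real.rpow_add_of_nonneg ht.1 ha hb).symm
    · simp
  · simp only [map_mul]
    exact hPS.mul hQS

theorem inner_opPower_comm {B : H →L[ℝ] H} (hB : B.IsPositive) {a : ℝ} (ha : 0 ≤ a) (x y : H) :
    ⟪opPower B a x, y⟫ = ⟪x, opPower B a y⟫ := by
  obtain ⟨P, hP, hPS⟩ := isOpPower_opPower hB ha
  have hev : ∀ z : H, Tendsto (fun n => Polynomial.aeval B (P n) z) atTop (𝓝 (opPower B a z)) :=
    fun z => ((ContinuousLinearMap.apply ℝ H z).continuous.tendsto _).comp hPS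
  have hpow : ∀ (j : ℕ) (x y : H), ⟪(B ^ j) x, y⟫ = ⟪x, (B ^ j) y⟫ := by
    intro j
    induction j with
    | zero => intro x y; simp
    | succ j ih =>
      intro x y
      have h1 : (B ^ (j + 1)) x = (B ^ j) (B x) := by rw [pow_succ]; rfl
      have h2 : (B ^ (j + 1)) y = B ((B ^ j) y) := by rw [pow_succ']; rfl
      rw [h1, h2, ih, hB.inner_left_eq_inner_right]
  have h1 := (hev x).inner (𝕜 := ℝ) (tendsto_const_nhds (x := y))
  have h2 := (tendsto_const_nhds (x := x)).inner (𝕜 := ℝ) (hev y)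
  refine tendsto_nhds_unique h1 (h2.congr fun n => ?_)
  rw [Polynomial.aeval_eq_sum_range]
  simp only [sum_apply, inner_sum, sum_inner, smul_apply,
    real_inner_smul_left, real_inner_smul_right, hpow]

/-- Interpolation inequality for the powers of a positive operator. -/
theorem norm_opPower_mul_le {B : H →L[ℝ] H} (hB : B.IsPositive) {a τ : ℝ} (ha : 0 ≤ a)
    (hτ0 : 0 ≤ τ) (hτ1 : τ ≤ 1) (x : H) :
    ‖opPower B (τ * a) x‖ ≤ ‖opPower B a x‖ ^ τ * ‖x‖ ^ (1 - τ) := by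
  rcases hτ0.eq_or_lt with rfl | hτ0
  -- The endpoints are treated apart because the Hölder exponents `1 / τ` and `1 / (1 - τ)` used
  -- below need `0 < τ < 1`.
  · simp [opPower_zero hB]
  rcases hτ1.eq_or_lt with rfl | hτ1
  · simp
  have hτa : 0 ≤ τ * a := by positivity
  obtain ⟨P, hP, hPS⟩ := isOpPower_opPower hB ha
  obtain ⟨Q, hQ, hQS⟩ := isOpPower_opPower hB hτa
  have hP2 := Metric.tendstoUniformlyOn_iff.1 (tendstoUniformlyOn_mul_of_bounded hP hP
    (fun t ht => abs_rpow_le_of_mem ha ht) (fun t ht => abs_rpow_le_of_mem ha ht))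
  have hQ2 := Metric.tendstoUniformlyOn_iff.1 (tendstoUniformlyOn_mul_of_bounded hQ hQ
    (fun t ht => abs_rpow_le_of_mem hτa ht) (fun t ht => abs_rpow_le_of_mem hτa ht))
  have hPx : Tendsto (fun n => ‖Polynomial.aeval B (P n) x‖ ^ 2) atTop
      (𝓝 (‖opPower B a x‖ ^ 2)) :=
    ((((ContinuousLinearMap.apply ℝ H x).continuous.tendsto _).comp hPS).norm).pow 2
  have hQx : Tendsto (fun n => ‖Polynomial.aeval B (Q n) x‖ ^ 2) atTop
      (𝓝 (‖opPower B (τ * a) x‖ ^ 2)) :=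
    ((((ContinuousLinearMap.apply ℝ H x).continuous.tendsto _).comp hQS).norm).pow 2
  -- At a fixed approximation stage everything is a finite sum and Hölder applies. The parameter `ε`
  -- absorbs the polynomial errors and is sent to zero at the end.
  have key : ∀ ε > 0, ‖opPower B (τ * a) x‖ ^ 2 ≤
      (‖opPower B a x‖ ^ 2 + ε * ‖x‖ ^ 2) ^ τ * (‖x‖ ^ 2) ^ (1 - τ) + ε * ‖x‖ ^ 2 := by
    intro ε hε
    have hR : Tendsto (fun n => (‖Polynomial.aeval B (P n) x‖ ^ 2 + ε * ‖x‖ ^ 2) ^ τ *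
        (‖x‖ ^ 2) ^ (1 - τ) + ε * ‖x‖ ^ 2) atTop (𝓝 ((‖opPower B a x‖ ^ 2 + ε * ‖x‖ ^ 2) ^ τ *
        (‖x‖ ^ 2) ^ (1 - τ) + ε * ‖x‖ ^ 2)) :=
      (((hPx.add_const _).rpow_const (Or.inr hτ0.le)).mul_const _).add_const _
    refine le_of_tendsto_of_tendsto hQx hR ?_
    filter_upwards [hP2 ε hε, hQ2 ε hε] with n h1 h2
    obtain ⟨N, w, μ, hw, hμ, hq⟩ := exists_quadrature hB x (max (P n).natDegree (Q n).natDegree)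
    have e0 := hq 1 (by simp)
    simp only [map_one, one_apply_eq_self, Polynomial.eval_one, one_pow, mul_one] at e0
    rw [hq (P n) (le_max_left _ _), hq (Q n) (le_max_right _ _), e0]
    have hsq : ∀ k, μ k ^ a * μ k ^ a = μ k ^ (2 * a) := fun k => by
      rw [← Real.rpow_add_of_nonneg (hμ k).1 ha ha, two_mul]
    have hsq' : ∀ k, μ k ^ (τ * a) * μ k ^ (τ * a) = (μ k ^ (2 * a)) ^ τ := fun k => by
      rw [← Real.rpow_add_of_nonneg (hμ k).1 hτa hτa, ← Real.rpow_mul (hμ k).1]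
      congr 1; ring
    have hold : ∑ k, w k * (μ k ^ (2 * a)) ^ τ ≤
        (∑ k, w k * μ k ^ (2 * a)) ^ τ * (∑ k, w k) ^ (1 - τ) := by
      have hconj : (1 / τ).HolderConjugate (1 / (1 - τ)) := by
        rw [Real.holderConjugate_iff]
        refine ⟨by rw [lt_div_iff₀ hτ0]; linarith, by simp⟩
      have h := Real.inner_le_Lp_mul_Lq_of_nonneg Finset.univ
        (f := fun k => (w k * μ k ^ (2 * a)) ^ τ) (g := fun k => w k ^ (1 - τ)) hconj
        (fun k _ => Real.rpow_nonneg (mul_nonneg (hw k) (Real.rpow_nonneg (hμ k).1 _)) _)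
        (fun k _ => Real.rpow_nonneg (hw k) _)
      have g1 : ∀ k, (w k * μ k ^ (2 * a)) ^ τ * w k ^ (1 - τ) = w k * (μ k ^ (2 * a)) ^ τ := by
        intro k
        rw [Real.mul_rpow (hw k) (Real.rpow_nonneg (hμ k).1 _), mul_right_comm,
          ← Real.rpow_add_of_nonneg (hw k) hτ0.le (by linarith)]
        simp
      have g2 : ∀ k, ((w k * μ k ^ (2 * a)) ^ τ) ^ (1 / τ) = w k * μ k ^ (2 * a) := by
        intro k
        rw [← Real.rpow_mul (mul_nonneg (hw k) (Real.rpow_nonneg (hμ k).1 _)),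
          mul_one_div_cancel hτ0.ne', Real.rpow_one]
      have g3 : ∀ k, (w k ^ (1 - τ)) ^ (1 / (1 - τ)) = w k := by
        intro k
        rw [← Real.rpow_mul (hw k), mul_one_div_cancel (by linarith), Real.rpow_one]
      simp only [g1, g2, g3, one_div_one_div] at h
      exact h
    have i1 : ∑ k, w k * (Q n).eval (μ k) ^ 2 ≤
        ∑ k, w k * (μ k ^ (2 * a)) ^ τ + ε * ∑ k, w k := by
      rw [Finset.mul_sum, ← Finset.sum_add_distrib]
      refine Finset.sum_le_sum fun k _ => ?_
      have := h2 _ (hμ k)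
      rw [hsq', Real.dist_eq, abs_lt] at this
      nlinarith [hw k, this.1]
    have i2 : ∑ k, w k * μ k ^ (2 * a) ≤
        ∑ k, w k * (P n).eval (μ k) ^ 2 + ε * ∑ k, w k := by
      rw [Finset.mul_sum, ← Finset.sum_add_distrib]
      refine Finset.sum_le_sum fun k _ => ?_
      have := h1 _ (hμ k)
      rw [hsq, Real.dist_eq, abs_lt] at this
      nlinarith [hw k, this.2]
    have i3 : 0 ≤ ∑ k, w k * μ k ^ (2 * a) :=
      Finset.sum_nonneg fun k _ => mul_nonneg (hw k) (Real.rpow_nonneg (hμ k).1 _)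
    have i4 : 0 ≤ ∑ k, w k := Finset.sum_nonneg fun k _ => hw k
    refine i1.trans (add_le_add_left (hold.trans ?_) _)
    exact mul_le_mul_of_nonneg_right (Real.rpow_le_rpow i3 i2 hτ0.le) (Real.rpow_nonneg i4 _)
  have hfin : ‖opPower B (τ * a) x‖ ^ 2 ≤
      (‖opPower B a x‖ ^ 2) ^ τ * (‖x‖ ^ 2) ^ (1 - τ) := by
    have hc : Tendsto (fun ε : ℝ => (‖opPower B a x‖ ^ 2 + ε * ‖x‖ ^ 2) ^ τ *
        (‖x‖ ^ 2) ^ (1 - τ) + ε * ‖x‖ ^ 2) (𝓝[>] 0) (𝓝 ((‖opPower B a x‖ ^ 2 + 0 * ‖x‖ ^ 2) ^ τ *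
        (‖x‖ ^ 2) ^ (1 - τ) + 0 * ‖x‖ ^ 2)) := by
      have hid : Tendsto (fun ε : ℝ => ε * ‖x‖ ^ 2) (𝓝[>] 0) (𝓝 (0 * ‖x‖ ^ 2)) :=
        (tendsto_id.mono_left nhdsWithin_le_nhds).mul_const _
      exact ((((tendsto_const_nhds.add hid).rpow_const (Or.inr hτ0.le)).mul_const _).add hid)
    have := ge_of_tendsto hc (eventually_mem_nhdsWithin.mono fun ε hε => key ε hε)
    simpa using this
  refine (sq_le_sq₀ (norm_nonneg _) (by positivity)).1 (hfin.trans_eq ?_)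
  rw [mul_pow, ← Real.rpow_natCast, ← Real.rpow_natCast, ← Real.rpow_natCast, ← Real.rpow_natCast,
    ← Real.rpow_mul (norm_nonneg _), ← Real.rpow_mul (norm_nonneg _),
    ← Real.rpow_mul (norm_nonneg _), ← Real.rpow_mul (norm_nonneg _), mul_comm τ, mul_comm (1 - τ)]

end OperatorPowers

end HilbertScale

namespace HilbertScale

/-! ### A Bernstein inequality in Hilbert space through the hyperbolic cosine. -/

section Concentration

/-- Here `w ^ 2` is the convex combination of `(r + s) ^ 2` and `(r - s) ^ 2` with weights `(1 ± σ)
/ 2`. The series of `cosh` has nonnegative coefficients and only even powers, so convexity of `y ↦ y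
^ n` on `[0, ∞)` gives the bound term by term. -/
theorem cosh_le_of_sq_eq {r s σ w : ℝ} (hσ : |σ| ≤ 1) (hw : w ^ 2 = r ^ 2 + s ^ 2 + 2 * σ * r * s) :
    Real.cosh w ≤ Real.cosh r * Real.cosh s + σ * Real.sinh r * Real.sinh s := by
  obtain ⟨h1, h2⟩ := abs_le.1 hσ
  have e : Real.cosh r * Real.cosh s + σ * Real.sinh r * Real.sinh s =
      (1 + σ) / 2 * Real.cosh (r + s) + (1 - σ) / 2 * Real.cosh (r - s) := by
    rw [Real.cosh_add, Real.cosh_sub]; ring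
  rw [e]
  refine hasSum_le (fun n => ?_) (Real.hasSum_cosh w)
    (((Real.hasSum_cosh (r + s)).mul_left _).add ((Real.hasSum_cosh (r - s)).mul_left _))
  have hc := (convexOn_pow (𝕜 := ℝ) n).2 (Set.mem_Ici.2 (sq_nonneg (r + s)))
    (Set.mem_Ici.2 (sq_nonneg (r - s))) (show 0 ≤ (1 + σ) / 2 by linarith)
    (show 0 ≤ (1 - σ) / 2 by linarith) (by ring)
  have hw' : w ^ 2 = (1 + σ) / 2 * (r + s) ^ 2 + (1 - σ) / 2 * (r - s) ^ 2 := by rw [hw]; ring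
  simp only [smul_eq_mul] at hc
  rw [← hw'] at hc
  rw [pow_mul, pow_mul, pow_mul, ← mul_div_assoc, ← mul_div_assoc, ← add_div]
  gcongr

variable {G : Type*} [NormedAddCommGroup G] [InnerProductSpace ℝ G]

/-- With `σ` the cosine of the angle between `x` and `y`, the part linear in `y` is isolated, since
it will have mean zero. The remainder `σ sinh ‖x‖ (sinh ‖y‖ - ‖y‖)` is absorbed using `σ sinh ‖x‖ ≤
cosh ‖x‖`, and `cosh + sinh = exp`. -/
theorem cosh_norm_add_le (x y : G) :
    Real.cosh ‖x + y‖ ≤ Real.cosh ‖x‖ * (Real.exp ‖y‖ - ‖y‖) +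
      Real.sinh ‖x‖ / ‖x‖ * ⟪x, y⟫ := by
  obtain ⟨σ, hσ, hin⟩ : ∃ σ : ℝ, |σ| ≤ 1 ∧ ⟪x, y⟫ = σ * ‖x‖ * ‖y‖ := by
    by_cases h : ‖x‖ * ‖y‖ = 0
    · refine ⟨0, by simp, ?_⟩
      have := abs_real_inner_le_norm x y
      rw [h] at this
      simpa using this
    · refine ⟨⟪x, y⟫ / (‖x‖ * ‖y‖), abs_real_inner_div_norm_mul_norm_le_one x y, ?_⟩
      rw [mul_assoc, div_mul_cancel₀ _ h]
  have h1 : Real.cosh ‖x + y‖ ≤ _ := cosh_le_of_sq_eq (r := ‖x‖) (s := ‖y‖) hσ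
    (by rw [norm_add_sq_real, hin]; ring)
  refine h1.trans ?_
  have h2 : Real.sinh ‖x‖ / ‖x‖ * ⟪x, y⟫ = σ * ‖y‖ * Real.sinh ‖x‖ := by
    rw [hin]
    by_cases h : ‖x‖ = 0
    · rw [h]; simp
    · field_simp
  rw [h2, ← Real.cosh_add_sinh ‖y‖]
  have h3 : ‖y‖ ≤ Real.sinh ‖y‖ := Real.self_le_sinh_iff.2 (norm_nonneg y)
  have h4 : 0 ≤ Real.sinh ‖x‖ := Real.sinh_nonneg_iff.2 (norm_nonneg x)
  have h5 : σ * Real.sinh ‖x‖ ≤ Real.cosh ‖x‖ :=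
    ((mul_le_mul_of_nonneg_right ((le_abs_self σ).trans hσ) h4).trans_eq (one_mul _)).trans
      (Real.sinh_lt_cosh _).le
  nlinarith [mul_le_mul_of_nonneg_right h5 (sub_nonneg.2 h3)]

variable {Ω : Type*} [MeasurableSpace Ω] {P : Measure Ω} [IsProbabilityMeasure P]

/-- The linear term integrates to zero, so a centered increment costs only a factor `1 + c`.
Independence then lets these factors multiply. -/
theorem lintegral_cosh_norm_add_le {ξ : Ω → G} (hξ : StronglyMeasurable ξ)
    (hint : Integrable ξ P) {c : ℝ} (hc0 : 0 ≤ c)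
    (hc : ∫⁻ ω, ENNReal.ofReal (Real.exp ‖ξ ω‖ - ‖ξ ω‖ - 1) ∂P ≤ ENNReal.ofReal c)
    (hmean : ∀ x : G, ∫ ω, ⟪x, ξ ω⟫ ∂P = 0) (x : G) :
    ∫⁻ ω, ENNReal.ofReal (Real.cosh ‖x + ξ ω‖) ∂P ≤
      ENNReal.ofReal (Real.cosh ‖x‖) * ENNReal.ofReal (1 + c) := by
  have hψ0 : ∀ ω, 0 ≤ Real.exp ‖ξ ω‖ - ‖ξ ω‖ - 1 := fun ω => by
    have := Real.add_one_le_exp ‖ξ ω‖; linarith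
  have hψm : AEStronglyMeasurable (fun ω => Real.exp ‖ξ ω‖ - ‖ξ ω‖ - 1) P :=
    (((Real.continuous_exp.comp_stronglyMeasurable hξ.norm).sub hξ.norm).sub
      stronglyMeasurable_const).aestronglyMeasurable
  have hψi : Integrable (fun ω => Real.exp ‖ξ ω‖ - ‖ξ ω‖ - 1) P := by
    refine ⟨hψm, ?_⟩
    rw [hasFiniteIntegral_iff_ofReal (Eventually.of_forall hψ0)]
    exact hc.trans_lt ENNReal.ofReal_lt_top
  have hψc : ∫ ω, (Real.exp ‖ξ ω‖ - ‖ξ ω‖ - 1) ∂P ≤ c := by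
    rw [integral_eq_lintegral_of_nonneg_ae (Eventually.of_forall hψ0) hψm]
    exact ENNReal.toReal_le_of_le_ofReal hc0 hc
  have hinner : Integrable (fun ω => ⟪x, ξ ω⟫) P := hint.const_inner x
  set F : Ω → ℝ := fun ω => Real.cosh ‖x‖ * (Real.exp ‖ξ ω‖ - ‖ξ ω‖ - 1) + Real.cosh ‖x‖ +
    Real.sinh ‖x‖ / ‖x‖ * ⟪x, ξ ω⟫ with hF
  have hle : ∀ ω, Real.cosh ‖x + ξ ω‖ ≤ F ω := fun ω => by
    have := cosh_norm_add_le x (ξ ω)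
    rw [hF]; dsimp only; linarith
  have hFi : Integrable F P :=
    ((hψi.const_mul _).add (integrable_const _)).add (hinner.const_mul _)
  calc ∫⁻ ω, ENNReal.ofReal (Real.cosh ‖x + ξ ω‖) ∂P ≤ ∫⁻ ω, ENNReal.ofReal (F ω) ∂P :=
        lintegral_mono fun ω => ENNReal.ofReal_le_ofReal (hle ω)
    _ = ENNReal.ofReal (∫ ω, F ω ∂P) := (ofReal_integral_eq_lintegral_ofReal hFi
        (Eventually.of_forall fun ω => (Real.cosh_pos _).le.trans (hle ω))).symm
    _ ≤ ENNReal.ofReal (Real.cosh ‖x‖ * (1 + c)) := by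
        refine ENNReal.ofReal_le_ofReal ?_
        have a1 : ∫ ω, F ω ∂P = ∫ ω, (Real.cosh ‖x‖ * (Real.exp ‖ξ ω‖ - ‖ξ ω‖ - 1) +
            Real.cosh ‖x‖) ∂P + ∫ ω, Real.sinh ‖x‖ / ‖x‖ * ⟪x, ξ ω⟫ ∂P :=
          integral_add ((hψi.const_mul _).add (integrable_const _)) (hinner.const_mul _)
        have a2 : ∫ ω, (Real.cosh ‖x‖ * (Real.exp ‖ξ ω‖ - ‖ξ ω‖ - 1) + Real.cosh ‖x‖) ∂P =
            ∫ ω, Real.cosh ‖x‖ * (Real.exp ‖ξ ω‖ - ‖ξ ω‖ - 1) ∂P + ∫ _, Real.cosh ‖x‖ ∂P :=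
          integral_add (hψi.const_mul _) (integrable_const _)
        rw [a1, a2, integral_const_mul, integral_const_mul, hmean]
        simp only [integral_const, probReal_univ, one_smul, mul_zero, add_zero]
        nlinarith [mul_le_mul_of_nonneg_left hψc (Real.cosh_pos ‖x‖).le]
    _ = _ := ENNReal.ofReal_mul (Real.cosh_pos _).le

theorem stronglyMeasurable_sum_pi {E : Type*} [NormedAddCommGroup E] {ξ : Ω → E}
    (hξ : StronglyMeasurable ξ) (n : ℕ) :
    StronglyMeasurable fun z : Fin n → Ω => ∑ i, ξ (z i) :=
  Finset.stronglyMeasurable_fun_sum _ fun i _ => hξ.comp_measurable (measurable_pi_apply i)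

theorem lintegral_cosh_norm_sum_le {ξ : Ω → G} (hξ : StronglyMeasurable ξ)
    (hint : Integrable ξ P) {c : ℝ} (hc0 : 0 ≤ c)
    (hc : ∫⁻ ω, ENNReal.ofReal (Real.exp ‖ξ ω‖ - ‖ξ ω‖ - 1) ∂P ≤ ENNReal.ofReal c)
    (hmean : ∀ x : G, ∫ ω, ⟪x, ξ ω⟫ ∂P = 0) (n : ℕ) :
    ∫⁻ z, ENNReal.ofReal (Real.cosh ‖∑ i, ξ (z i)‖) ∂(Measure.pi fun _ : Fin n => P) ≤
      ENNReal.ofReal (1 + c) ^ n := by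
  induction n with
  | zero => simp
  | succ n ih =>
    have hmeas : Measurable fun z : Ω × (Fin n → Ω) =>
        ENNReal.ofReal (Real.cosh ‖(∑ i, ξ (z.2 i)) + ξ z.1‖) := by
      refine ENNReal.measurable_ofReal.comp (Real.measurable_cosh.comp ?_)
      exact (((stronglyMeasurable_sum_pi hξ n).comp_measurable measurable_snd).add
        (hξ.comp_measurable measurable_fst)).norm.measurable
    have hmp := measurePreserving_piFinSuccAbove (fun _ : Fin (n + 1) => P) 0
    have e1 : ∫⁻ z, ENNReal.ofReal (Real.cosh ‖∑ i, ξ (z i)‖)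
          ∂(Measure.pi fun _ : Fin (n + 1) => P) =
        ∫⁻ z, ENNReal.ofReal (Real.cosh ‖(∑ i, ξ (z.2 i)) + ξ z.1‖)
          ∂(P.prod (Measure.pi fun _ : Fin n => P)) := by
      rw [← hmp.lintegral_comp hmeas]
      refine lintegral_congr fun z => ?_
      rw [Fin.sum_univ_succ, add_comm]
      simp [MeasurableEquiv.piFinSuccAbove, Fin.tail]
    rw [e1, lintegral_prod_symm _ hmeas.aemeasurable]
    calc ∫⁻ z : Fin n → Ω, ∫⁻ ω, ENNReal.ofReal (Real.cosh ‖(∑ i, ξ (z i)) + ξ ω‖) ∂P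
          ∂(Measure.pi fun _ : Fin n => P)
        ≤ ∫⁻ z : Fin n → Ω, ENNReal.ofReal (Real.cosh ‖∑ i, ξ (z i)‖) * ENNReal.ofReal (1 + c)
          ∂(Measure.pi fun _ : Fin n => P) :=
          lintegral_mono fun z => lintegral_cosh_norm_add_le hξ hint hc0 hc hmean _
      _ = (∫⁻ z : Fin n → Ω, ENNReal.ofReal (Real.cosh ‖∑ i, ξ (z i)‖)
          ∂(Measure.pi fun _ : Fin n => P)) * ENNReal.ofReal (1 + c) :=
          lintegral_mul_const' _ _ ENNReal.ofReal_ne_top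
      _ ≤ ENNReal.ofReal (1 + c) ^ (n + 1) := by
          rw [pow_succ]; gcongr

/-- Bernstein-type inequality for sums of independent, identically distributed, centered random
vectors of a Hilbert space. -/
theorem measure_norm_sum_gt_le {ξ : Ω → G} (hξ : StronglyMeasurable ξ)
    (hint : Integrable ξ P) (hmean : ∀ x : G, ∫ ω, ⟪x, ξ ω⟫ ∂P = 0) {b V : ℝ} (hb : 0 < b)
    (hV : 0 ≤ V)
    (hψ : ∀ t : ℝ, 0 ≤ t → t * b ≤ 1 →
      ∫⁻ ω, ENNReal.ofReal (Real.exp (t * ‖ξ ω‖) - t * ‖ξ ω‖ - 1) ∂P ≤ ENNReal.ofReal (t ^ 2 * V))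
    (n : ℕ) {η : ℝ} (hη0 : 0 < η) (hη1 : η < 1) :
    Measure.pi (fun _ : Fin n => P)
      {z | 2 * (b + √(n * V)) * Real.log (4 / η) < ‖∑ i, ξ (z i)‖} ≤ ENNReal.ofReal (η / 2) := by
  set v := √(n * V) with hv
  have hv0 : 0 ≤ v := Real.sqrt_nonneg _
  have hvsq : v ^ 2 = n * V := Real.sq_sqrt (by positivity)
  -- This choice gives `t b ≤ 1`, so the moment hypothesis applies, and `n t ^ 2 V ≤ 1`, so the
  -- expected `cosh` is at most `exp 1`.
  set t := 1 / (b + v) with ht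
  have hbv : 0 < b + v := by positivity
  have ht0 : 0 < t := by positivity
  have htb : t * b ≤ 1 := by
    rw [ht, one_div_mul_eq_div, div_le_one hbv]; linarith
  have htv : n * (t ^ 2 * V) ≤ 1 := by
    have h1 : t * v ≤ 1 := by rw [ht, one_div_mul_eq_div, div_le_one hbv]; linarith
    calc n * (t ^ 2 * V) = (t * v) ^ 2 := by rw [mul_pow, hvsq]; ring
      _ ≤ 1 := pow_le_one₀ (by positivity) h1
  have hnorm : ∀ ω, ‖t • ξ ω‖ = t * ‖ξ ω‖ := fun ω => by
    rw [norm_smul, Real.norm_of_nonneg ht0.le]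
  have hmgf := lintegral_cosh_norm_sum_le (P := P) (ξ := fun ω => t • ξ ω) (hξ.const_smul t)
    (hint.smul t) (c := t ^ 2 * V) (by positivity)
    (by simp only [hnorm]; exact hψ t ht0.le htb)
    (fun x => by simp only [real_inner_smul_right]; rw [integral_const_mul, hmean, mul_zero]) n
  have hnorm' : ∀ z : Fin n → Ω, ‖∑ i, t • ξ (z i)‖ = t * ‖∑ i, ξ (z i)‖ := fun z => by
    rw [← Finset.smul_sum, norm_smul, Real.norm_of_nonneg ht0.le]
  simp only [hnorm'] at hmgf
  set Λ := Real.log (4 / η) with hΛ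
  have h4η : 0 < 4 / η := by positivity
  have hexpΛ : Real.exp Λ = 4 / η := Real.exp_log h4η
  have hΛ0 : 0 ≤ Λ := Real.log_nonneg (by rw [le_div_iff₀ hη0]; linarith)
  have hbound : ENNReal.ofReal (1 + t ^ 2 * V) ^ n ≤ ENNReal.ofReal (Real.exp 1) := by
    rw [← ENNReal.ofReal_pow (by positivity)]
    refine ENNReal.ofReal_le_ofReal ?_
    calc (1 + t ^ 2 * V) ^ n ≤ Real.exp (t ^ 2 * V) ^ n := by
          gcongr
          rw [add_comm]
          exact Real.add_one_le_exp _
      _ = Real.exp (n * (t ^ 2 * V)) := (Real.exp_nat_mul _ _).symm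
      _ ≤ Real.exp 1 := Real.exp_le_exp.2 htv
  have hSm := stronglyMeasurable_sum_pi hξ n
  -- Markov at level `exp (2 Λ) / 2 ≤ cosh (2 Λ)`, where `exp (2 Λ) = (4 / η) ^ 2`. The resulting
  -- probability `e η ^ 2 / 8` is below `η / 2` because `e η < 4`.
  have hmarkov := mul_meas_ge_le_lintegral₀ (μ := Measure.pi fun _ : Fin n => P)
    (f := fun z => ENNReal.ofReal (Real.cosh (t * ‖∑ i, ξ (z i)‖)))
    (ENNReal.measurable_ofReal.comp (Real.measurable_cosh.comp
      (hSm.norm.measurable.const_mul t))).aemeasurable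
    (ENNReal.ofReal (Real.exp (2 * Λ) / 2))
  have hsub : {z : Fin n → Ω | 2 * (b + v) * Λ < ‖∑ i, ξ (z i)‖} ⊆
      {z | ENNReal.ofReal (Real.exp (2 * Λ) / 2) ≤
        ENNReal.ofReal (Real.cosh (t * ‖∑ i, ξ (z i)‖))} := by
    intro z hz
    refine ENNReal.ofReal_le_ofReal ?_
    have h1 : 2 * Λ ≤ t * ‖∑ i, ξ (z i)‖ := by
      have h2 : t * (2 * (b + v) * Λ) ≤ t * ‖∑ i, ξ (z i)‖ :=
        mul_le_mul_of_nonneg_left (le_of_lt hz) ht0.le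
      have h3 : t * (2 * (b + v) * Λ) = 2 * Λ := by
        rw [ht]; field_simp
      linarith
    rw [Real.cosh_eq]
    have h2 := Real.exp_le_exp.2 h1
    have h3 := Real.exp_pos (-(t * ‖∑ i, ξ (z i)‖))
    linarith
  have hfinal := (mul_le_mul_right (measure_mono hsub) _).trans (hmarkov.trans (hmgf.trans hbound))
  have hpos : 0 < Real.exp (2 * Λ) / 2 := by positivity
  have hdiv : Measure.pi (fun _ : Fin n => P) {z : Fin n → Ω | 2 * (b + v) * Λ < ‖∑ i, ξ (z i)‖}
      ≤ ENNReal.ofReal (Real.exp 1) / ENNReal.ofReal (Real.exp (2 * Λ) / 2) := by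
    rw [ENNReal.le_div_iff_mul_le (Or.inl (by simpa using Real.exp_pos _))
      (Or.inl ENNReal.ofReal_ne_top), mul_comm]
    exact hfinal
  refine hdiv.trans ?_
  rw [← ENNReal.ofReal_div_of_pos hpos]
  refine ENNReal.ofReal_le_ofReal ?_
  rw [two_mul Λ, Real.exp_add, hexpΛ, div_le_iff₀ (by positivity)]
  have h1 := Real.exp_one_lt_d9
  have h2 : η / 2 * (4 / η * (4 / η) / 2) = 4 / η := by field_simp; norm_num
  rw [h2, le_div_iff₀ hη0]
  nlinarith [Real.exp_pos 1]

end Concentration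

end HilbertScale

namespace HilbertScale

/-! ### Hilbert–Schmidt norms. -/

section HilbertSchmidt

variable {E : Type*} [NormedAddCommGroup E] [InnerProductSpace ℝ E]
  {F : Type*} [NormedAddCommGroup F] [InnerProductSpace ℝ F]
  {G : Type*} [NormedAddCommGroup G] [InnerProductSpace ℝ G]

/-- Basis vectors are `√2` apart, so balls of radius `1 / 2` around them are disjoint. Countability
is what permits exchanging sums over the basis with integrals and measurable limits. -/
theorem _root_.HilbertBasis.countable_of_separable [TopologicalSpace.SeparableSpace E] {ι : Type*}
    (b : HilbertBasis ι ℝ E) : Countable ι := by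
  refine Pairwise.countable_of_isOpen_disjoint (s := fun i => Metric.ball (b i) (1 / 2))
    (fun i j hij => Metric.ball_disjoint_ball ?_) (fun i => Metric.isOpen_ball)
    (fun i => Metric.nonempty_ball.2 (by norm_num))
  have h1 : ‖b i - b j‖ ^ 2 = 2 := by
    rw [norm_sub_sq_real, b.orthonormal.2 hij, b.orthonormal.1 i, b.orthonormal.1 j]; norm_num
  rw [dist_eq_norm]
  nlinarith [norm_nonneg (b i - b j)]

theorem ofReal_norm_sq_eq_tsum {ι : Type*} (b : HilbertBasis ι ℝ E) (x : E) :
    ENNReal.ofReal (‖x‖ ^ 2) = ∑' i, ENNReal.ofReal (⟪x, b i⟫ ^ 2) := by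
  have h := b.hasSum_inner_mul_inner x x
  have h' : HasSum (fun i => ⟪x, b i⟫ ^ 2) (‖x‖ ^ 2) := by
    rw [real_inner_self_eq_norm_sq] at h
    simpa only [real_inner_comm x, ← sq] using h
  rw [← h'.tsum_eq, ENNReal.ofReal_tsum_of_nonneg (fun i => sq_nonneg _) h'.summable]

theorem hsNormSq_comp_le [CompleteSpace E] (A : F →L[ℝ] G) (S : E →L[ℝ] F) :
    hsNormSq (A ∘L S) ≤ ENNReal.ofReal (‖A‖ ^ 2) * hsNormSq S := by
  rw [hsNormSq, hsNormSq, ← ENNReal.tsum_mul_left]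
  refine ENNReal.tsum_le_tsum fun i => ?_
  rw [← ENNReal.ofReal_mul (by positivity), ← mul_pow]
  exact ENNReal.ofReal_le_ofReal (by gcongr; exact A.le_opNorm _)

variable [CompleteSpace E] [CompleteSpace F] [CompleteSpace G]

/-- Both sides are the double sum of squared matrix entries, and sums in `[0, ∞]` may be exchanged.
-/
theorem hsNormSq_adjoint (S : E →L[ℝ] F) : hsNormSq S.adjoint = hsNormSq S := by
  simp only [hsNormSq]
  simp_rw [ofReal_norm_sq_eq_tsum (stdBasis E) (S.adjoint _),
    ofReal_norm_sq_eq_tsum (stdBasis F) (S _)]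
  rw [ENNReal.tsum_comm]
  simp_rw [ContinuousLinearMap.adjoint_inner_left, real_inner_comm (stdBasis F _)]

theorem hsNormSq_comp_le' (S : F →L[ℝ] G) (A : E →L[ℝ] F) :
    hsNormSq (S ∘L A) ≤ ENNReal.ofReal (‖A‖ ^ 2) * hsNormSq S := by
  rw [← hsNormSq_adjoint, ContinuousLinearMap.adjoint_comp, ← hsNormSq_adjoint S,
    ← LinearIsometryEquiv.norm_map ContinuousLinearMap.adjoint A]
  exact hsNormSq_comp_le _ _

theorem norm_apply_le_of_hsNormSq_le (S : E →L[ℝ] F) {c : ℝ} (hc : 0 ≤ c)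
    (h : hsNormSq S ≤ ENNReal.ofReal (c ^ 2)) (x : E) : ‖S x‖ ≤ c * ‖x‖ := by
  have := norm_adjoint_apply_le S.adjoint hc (by rwa [hsNormSq_adjoint]) x
  rwa [ContinuousLinearMap.adjoint_adjoint] at this

theorem norm_apply_le_sqrt_hsNormSq (S : E →L[ℝ] F) (h : hsNormSq S ≠ ∞) (x : E) :
    ‖S x‖ ≤ √(hsNormSq S).toReal * ‖x‖ := by
  refine norm_apply_le_of_hsNormSq_le S (Real.sqrt_nonneg _) ?_ x
  rw [Real.sq_sqrt ENNReal.toReal_nonneg, ENNReal.ofReal_toReal h]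

end HilbertSchmidt

/-! ### The resolvent and the whitening operator of a positive operator. -/

section Whitening

variable {E : Type*} [NormedAddCommGroup E] [InnerProductSpace ℝ E] [CompleteSpace E]

/-- The resolvent `(T + t I)⁻¹`. -/
noncomputable def resolvent (T : E →L[ℝ] E) (t : ℝ) : E →L[ℝ] E :=
  Ring.inverse (T + t • (1 : E →L[ℝ] E))

variable {T : E →L[ℝ] E} {t : ℝ}

/-- Coercivity `⟪(T + t) x, x⟫ ≥ t ‖x‖ ^ 2` forces invertibility, so `Ring.inverse` is a genuine
inverse and not its default value. -/
theorem isUnit_add_smul_one (hT : T.IsPositive) (ht : 0 < t) :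
    IsUnit (T + t • (1 : E →L[ℝ] E)) := by
  refine ContinuousLinearMap.isUnit_of_forall_le_norm_inner_map _ (c := ⟨t, ht.le⟩) ht fun x => ?_
  have h1 : ⟪(T + t • (1 : E →L[ℝ] E)) x, x⟫ = ⟪T x, x⟫ + t * ‖x‖ ^ 2 := by
    simp [inner_add_left, real_inner_smul_left]
  rw [h1, Real.norm_eq_abs]
  refine le_trans ?_ (le_abs_self _)
  have := hT.inner_nonneg_left x
  change ‖x‖ ^ 2 * t ≤ _
  linarith

theorem apply_resolvent (hT : T.IsPositive) (ht : 0 < t) (x : E) :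
    T (resolvent T t x) + t • resolvent T t x = x := by
  have h := Ring.mul_inverse_cancel _ (isUnit_add_smul_one hT ht)
  have h' := congrArg (fun S : E →L[ℝ] E => S x) h
  simpa [resolvent] using h'

theorem resolvent_apply (hT : T.IsPositive) (ht : 0 < t) (x : E) :
    resolvent T t (T x + t • x) = x := by
  have h := Ring.inverse_mul_cancel _ (isUnit_add_smul_one hT ht)
  have h' := congrArg (fun S : E →L[ℝ] E => S x) h
  simpa [resolvent] using h'

theorem resolvent_comm (hT : T.IsPositive) (ht : 0 < t) (x : E) :
    resolvent T t (T x) = T (resolvent T t x) := by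
  have h1 := resolvent_apply hT ht (T (resolvent T t x))
  rw [← map_smul, ← map_add, apply_resolvent hT ht] at h1
  exact h1

theorem inner_resolvent_comm (hT : T.IsPositive) (ht : 0 < t) (x y : E) :
    ⟪resolvent T t x, y⟫ = ⟪x, resolvent T t y⟫ := by
  conv_lhs => rw [← apply_resolvent hT ht y]
  conv_rhs => rw [← apply_resolvent hT ht x]
  rw [inner_add_left, inner_add_right, hT.inner_left_eq_inner_right, real_inner_smul_left,
    real_inner_smul_right]

theorem mul_norm_resolvent_sq_le (hT : T.IsPositive) (ht : 0 < t) (x : E) :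
    t * ‖resolvent T t x‖ ^ 2 ≤ ⟪resolvent T t x, x⟫ := by
  have h := hT.inner_nonneg_left (resolvent T t x)
  have h1 : ⟪resolvent T t x, x⟫ =
      ⟪resolvent T t x, T (resolvent T t x) + t • resolvent T t x⟫ := by
    rw [apply_resolvent hT ht]
  rw [h1, inner_add_right, real_inner_smul_right, real_inner_self_eq_norm_sq, real_inner_comm]
  linarith

theorem isPositive_resolvent (hT : T.IsPositive) (ht : 0 < t) : (resolvent T t).IsPositive :=
  ⟨fun x y => inner_resolvent_comm hT ht x y, fun x =>
    (by positivity : (0 : ℝ) ≤ t * ‖resolvent T t x‖ ^ 2).trans (mul_norm_resolvent_sq_le hT ht x)⟩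

theorem inner_resolvent_le (hT : T.IsPositive) (ht : 0 < t) (x : E) :
    ⟪resolvent T t x, x⟫ ≤ ‖x‖ ^ 2 / t := by
  have h1 := mul_norm_resolvent_sq_le hT ht x
  have h2 := real_inner_le_norm (resolvent T t x) x
  set a := ‖resolvent T t x‖
  have ha : 0 ≤ a := norm_nonneg _
  rw [le_div_iff₀ ht]
  nlinarith [sq_nonneg (t * a - ‖x‖), norm_nonneg x]

/-- The whitening operator `(T + t I) ^ (-1/2)`. -/
noncomputable def whitening (T : E →L[ℝ] E) (t : ℝ) : E →L[ℝ] E := opPower (resolvent T t) (1 / 2)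

theorem whitening_whitening (hT : T.IsPositive) (ht : 0 < t) (x : E) :
    whitening T t (whitening T t x) = resolvent T t x := by
  have h := opPower_add (isPositive_resolvent hT ht) (a := 1 / 2) (b := 1 / 2) (by norm_num)
    (by norm_num)
  rw [add_halves, opPower_one (isPositive_resolvent hT ht)] at h
  conv_rhs => rw [h]
  rfl

theorem inner_whitening_comm (hT : T.IsPositive) (ht : 0 < t) (x y : E) :
    ⟪whitening T t x, y⟫ = ⟪x, whitening T t y⟫ :=
  inner_opPower_comm (isPositive_resolvent hT ht) (by norm_num) x y

theorem opPower_commute {B : E →L[ℝ] E} (hB : B.IsPositive) {a : ℝ} (ha : 0 ≤ a)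
    (h : Commute B T) : Commute (opPower B a) T := by
  obtain ⟨P, -, hP⟩ := isOpPower_opPower hB ha
  refine tendsto_nhds_unique (hP.mul_const T) ((hP.const_mul T).congr fun n => ?_)
  rw [Polynomial.aeval_eq_sum_range]
  exact (Commute.sum_left _ _ _ fun i _ => (h.pow_left i).smul_left _).eq.symm

theorem whitening_comm (hT : T.IsPositive) (ht : 0 < t) (x : E) :
    whitening T t (T x) = T (whitening T t x) := by
  have h : Commute (whitening T t) T :=
    opPower_commute (isPositive_resolvent hT ht) (by norm_num)
      (ContinuousLinearMap.ext fun y => resolvent_comm hT ht y)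
  exact congrArg (fun S : E →L[ℝ] E => S x) h.eq

theorem norm_whitening_sq_le (hT : T.IsPositive) (ht : 0 < t) (x : E) :
    ‖whitening T t x‖ ^ 2 ≤ ‖x‖ ^ 2 / t := by
  rw [← real_inner_self_eq_norm_sq, ← inner_whitening_comm hT ht, whitening_whitening hT ht]
  exact inner_resolvent_le hT ht x

theorem opNorm_whitening_sq_le (hT : T.IsPositive) (ht : 0 < t) : ‖whitening T t‖ ^ 2 ≤ 1 / t := by
  have h : ‖whitening T t‖ ≤ √(1 / t) := by
    refine ContinuousLinearMap.opNorm_le_bound _ (Real.sqrt_nonneg _) fun x => ?_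
    refine (sq_le_sq₀ (norm_nonneg _) (by positivity)).1 ?_
    rw [mul_pow, Real.sq_sqrt (by positivity), one_div_mul_eq_div]
    exact norm_whitening_sq_le hT ht x
  calc ‖whitening T t‖ ^ 2 ≤ √(1 / t) ^ 2 := by gcongr
    _ = 1 / t := Real.sq_sqrt (by positivity)

/-- With `W` the whitening operator, write `g = W W (T + t) g`, move one `W` across and apply
Cauchy–Schwarz; `‖W (T + t) g‖ ^ 2 = ⟪(T + t) g, g⟫`. This separates each random pairing into the
energy of `g` and a whitened deviation. -/
theorem abs_inner_le_whitening (hT : T.IsPositive) (ht : 0 < t) (g x : E) :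
    |⟪g, x⟫| ≤ √(⟪T g, g⟫ + t * ‖g‖ ^ 2) * ‖whitening T t x‖ := by
  set y := T g + t • g with hy
  have h1 : g = whitening T t (whitening T t y) := by
    rw [whitening_whitening hT ht, hy, resolvent_apply hT ht]
  have h2 : ‖whitening T t y‖ = √(⟪T g, g⟫ + t * ‖g‖ ^ 2) := by
    rw [← Real.sqrt_sq (norm_nonneg (whitening T t y)), ← real_inner_self_eq_norm_sq,
      inner_whitening_comm hT ht, ← h1, hy, inner_add_left, real_inner_smul_left,
      real_inner_self_eq_norm_sq]
  rw [← h2]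
  conv_lhs => rw [h1]
  rw [inner_whitening_comm hT ht]
  exact abs_real_inner_le_norm _ _

theorem inner_resolvent_comp_eq (hT : T.IsPositive) (ht : 0 < t) (x : E) :
    ⟪x, resolvent T t (T x)⟫ = ⟪T (whitening T t x), whitening T t x⟫ := by
  rw [← whitening_whitening hT ht, ← inner_whitening_comm hT ht, whitening_comm hT ht,
    real_inner_comm]

/-- By the resolvent identity the difference is `(t - s) ⟪x, T η⟫` with `η = (T + s)⁻¹ (T + t)⁻¹ x`.
Summed over a basis, this makes the effective dimension nonincreasing. -/
theorem inner_resolvent_comp_anti (hT : T.IsPositive) {s : ℝ} (hs : 0 < s) (hst : s ≤ t) (x : E) :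
    ⟪x, resolvent T t (T x)⟫ ≤ ⟪x, resolvent T s (T x)⟫ := by
  have ht : 0 < t := hs.trans_le hst
  set z := resolvent T t x with hz
  set η := resolvent T s z with hη
  have e1 : T z + t • z = x := apply_resolvent hT ht x
  have e2 : T η + s • η = z := apply_resolvent hT hs z
  have e3 : resolvent T s x = T η + t • η := by
    rw [← e1, map_add, map_smul, resolvent_comm hT hs]
  have e4 : resolvent T s (T x) - resolvent T t (T x) = (t - s) • T η := by
    rw [resolvent_comm hT hs, resolvent_comm hT ht, e3, ← hz, ← e2]
    simp only [map_add, map_smul]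
    module
  -- Expanding `x = (T + t) (T + s) η` leaves only nonnegative terms.
  have e5 : 0 ≤ ⟪x, T η⟫ := by
    have hx : x = T (T η) + (s + t) • T η + (s * t) • η := by
      rw [← e1, ← e2]
      simp only [map_add, map_smul]
      module
    rw [hx, inner_add_left, inner_add_left, real_inner_smul_left, real_inner_smul_left,
      real_inner_self_eq_norm_sq, real_inner_comm (T η) η]
    have h1 := hT.inner_nonneg_left (T η)
    have h2 := hT.inner_nonneg_left η
    positivity
  have e6 : ⟪x, resolvent T s (T x)⟫ - ⟪x, resolvent T t (T x)⟫ = (t - s) * ⟪x, T η⟫ := by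
    rw [← inner_sub_right, e4, real_inner_smul_right]
  nlinarith [mul_nonneg (sub_nonneg.2 hst) e5]

end Whitening

end HilbertScale

namespace HilbertScale

/-! ### Strong measurability in Hilbert spaces and in spaces of square-summable families. -/

section Measurability

variable {Ω : Type*} [MeasurableSpace Ω]
  {E : Type*} [NormedAddCommGroup E]

/-- Weak measurability implies strong measurability in a separable Hilbert space. -/
theorem stronglyMeasurable_of_inner [InnerProductSpace ℝ E] [CompleteSpace E]
    [TopologicalSpace.SeparableSpace E] {f : Ω → E}
    (h : ∀ w : E, Measurable fun ω => ⟪f ω, w⟫) :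
    StronglyMeasurable f := by
  let b := stdBasis E
  have hc : Countable (stdIndex E) := b.countable_of_separable
  refine stronglyMeasurable_of_tendsto (atTop : Filter (Finset (stdIndex E)))
    (f := fun s ω => ∑ i ∈ s, ⟪f ω, b i⟫ • b i) (fun s => ?_) ?_
  · exact Finset.stronglyMeasurable_fun_sum _ fun i _ =>
      (h (b i)).stronglyMeasurable.smul stronglyMeasurable_const
  · rw [tendsto_pi_nhds]
    intro ω
    have := b.hasSum_repr (f ω)
    simp only [b.repr_apply_apply, real_inner_comm (f ω)] at this
    exact this

variable {ι : Type*} [Countable ι]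

theorem stronglyMeasurable_lp {f : Ω → lp (fun _ : ι => E) 2}
    (h : ∀ i, StronglyMeasurable fun ω => f ω i) : StronglyMeasurable f := by
  classical
  refine stronglyMeasurable_of_tendsto (atTop : Filter (Finset ι))
    (f := fun s ω => ∑ i ∈ s, lp.single 2 i (f ω i)) (fun s => ?_) ?_
  · exact Finset.stronglyMeasurable_fun_sum _ fun i _ =>
      (lp.isometry_single (E := fun _ : ι => E) (p := 2) i).continuous.comp_stronglyMeasurable (h i)
  · rw [tendsto_pi_nhds]
    intro ω
    exact lp.hasSum_single (by simp) (f ω)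

end Measurability

/-! ### Hilbert–Schmidt operators as square-summable families of columns. -/

section HilbertSchmidtFamily

variable {E : Type*} [NormedAddCommGroup E] [InnerProductSpace ℝ E] [CompleteSpace E]
  {F : Type*} [NormedAddCommGroup F]

theorem ofReal_norm_sq_lp {ι : Type*} (a : lp (fun _ : ι => F) 2) :
    ENNReal.ofReal (‖a‖ ^ 2) = ∑' i, ENNReal.ofReal (‖a i‖ ^ 2) := by
  have h := lp.hasSum_norm (p := 2) (by norm_num) a
  simp only [ENNReal.toReal_ofNat, Real.rpow_two] at h
  rw [← h.tsum_eq, ENNReal.ofReal_tsum_of_nonneg (fun i => sq_nonneg _) h.summable]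

variable [InnerProductSpace ℝ F]

theorem memℓp_of_hsNormSq {S : E →L[ℝ] F} (h : hsNormSq S ≠ ∞) :
    Memℓp (E := fun _ : stdIndex E => F) (fun i => S (stdBasis E i)) 2 := by
  refine memℓp_gen ((ENNReal.summable_toReal h).congr fun i => ?_)
  rw [ENNReal.toReal_ofReal (by positivity)]
  simp

/-- The family of columns `S (e i)` lives in a Hilbert space, where the Bernstein inequality
applies. Its norm dominates the operator norm, so one scalar event controls `S x` for every `x`. -/
theorem norm_apply_le_lp [CompleteSpace F] {S : E →L[ℝ] F} {a : lp (fun _ : stdIndex E => F) 2}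
    (h : ∀ i, a i = S (stdBasis E i)) (x : E) : ‖S x‖ ≤ ‖a‖ * ‖x‖ := by
  refine norm_apply_le_of_hsNormSq_le S (norm_nonneg _) ?_ x
  rw [ofReal_norm_sq_lp, hsNormSq]
  simp only [h, le_refl]

end HilbertSchmidtFamily

/-! ### The covariance operator, whitened kernels and the effective dimension. -/

section EffectiveDimension

variable {X : Type*} [MeasurableSpace X]
  {Y : Type*} [NormedAddCommGroup Y] [InnerProductSpace ℝ Y] [CompleteSpace Y]
  {H' : Type*} [NormedAddCommGroup H'] [InnerProductSpace ℝ H'] [CompleteSpace H']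
  [RKHS ℝ H' X Y] {κ : ℝ}

theorem norm_kerFun_le (hK : IsBoundedMeasurableKernel H' κ) (x : X) :
    ‖RKHS.kerFun H' x‖ ≤ κ :=
  ContinuousLinearMap.opNorm_le_bound _ hK.nonneg fun v =>
    norm_apply_le_of_hsNormSq_le _ hK.nonneg (hK.hs_le x) v

variable [TopologicalSpace.SeparableSpace Y] [MeasurableSpace Y] [BorelSpace Y]
  (hK : IsBoundedMeasurableKernel H' κ) (ν : Measure X) [IsProbabilityMeasure ν]

theorem coeFn_embL2 (g : H') : embL2 hK ν g =ᵐ[ν] fun x => g x :=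
  (memLp_apply hK ν g).coeFn_toLp

theorem inner_embL2 (g h : H') : ⟪embL2 hK ν g, embL2 hK ν h⟫ = ∫ x, ⟪g x, h x⟫ ∂ν := by
  rw [L2.inner_def]
  refine integral_congr_ae ?_
  filter_upwards [coeFn_embL2 hK ν g, coeFn_embL2 hK ν h] with x h1 h2
  rw [h1, h2]

theorem integrable_inner_apply (hK : IsBoundedMeasurableKernel H' κ) (ν : Measure X)
    [IsProbabilityMeasure ν] (g h : H') : Integrable (fun x => ⟪g x, h x⟫) ν := by
  refine (L2.integrable_inner (𝕜 := ℝ) (embL2 hK ν g) (embL2 hK ν h)).congr ?_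
  filter_upwards [coeFn_embL2 hK ν g, coeFn_embL2 hK ν h] with x h1 h2
  rw [h1, h2]

theorem lintegral_norm_sq_apply (g : H') :
    ∫⁻ x, ENNReal.ofReal (‖g x‖ ^ 2) ∂ν = ENNReal.ofReal (‖embL2 hK ν g‖ ^ 2) := by
  rw [← real_inner_self_eq_norm_sq, inner_embL2]
  simp_rw [← real_inner_self_eq_norm_sq]
  exact (ofReal_integral_eq_lintegral_ofReal (integrable_inner_apply hK ν g g)
    (Eventually.of_forall fun x => real_inner_self_nonneg)).symm

theorem inner_covOp (g h : H') : ⟪covOp hK ν g, h⟫ = ⟪embL2 hK ν g, embL2 hK ν h⟫ := by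
  rw [covOp, ContinuousLinearMap.comp_apply, ContinuousLinearMap.adjoint_inner_left]

theorem inner_covOp_self (g : H') : ⟪covOp hK ν g, g⟫ = ‖embL2 hK ν g‖ ^ 2 := by
  rw [inner_covOp, real_inner_self_eq_norm_sq]

theorem isPositive_covOp : (covOp hK ν).IsPositive :=
  ContinuousLinearMap.isPositive_adjoint_comp_self _

theorem effDim_eq (t : ℝ) : effDim hK ν t =
    ∑' i, ⟪stdBasis H' i, resolvent (covOp hK ν) t (covOp hK ν (stdBasis H' i))⟫ := rfl

/-- The operator `(T_ν + t I) ^ (-1/2) K_x`. -/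
noncomputable def whitenedKer (t : ℝ) (x : X) : Y →L[ℝ] H' :=
  whitening (covOp hK ν) t ∘L RKHS.kerFun H' x

variable {t : ℝ}

theorem hsNormSq_whitenedKer_le (ht : 0 < t) (x : X) :
    hsNormSq (whitenedKer hK ν t x) ≤ ENNReal.ofReal (κ ^ 2 / t) := by
  refine (hsNormSq_comp_le _ _).trans ?_
  calc _ ≤ ENNReal.ofReal (1 / t) * ENNReal.ofReal (κ ^ 2) :=
        mul_le_mul' (ENNReal.ofReal_le_ofReal
          (opNorm_whitening_sq_le (isPositive_covOp hK ν) ht)) (hK.hs_le x)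
    _ = _ := by rw [← ENNReal.ofReal_mul (by positivity), one_div_mul_eq_div]

theorem hsNormSq_whitenedKer_ne_top (ht : 0 < t) (x : X) :
    hsNormSq (whitenedKer hK ν t x) ≠ ∞ :=
  ne_top_of_le_ne_top ENNReal.ofReal_ne_top (hsNormSq_whitenedKer_le hK ν ht x)

theorem lintegral_hsNormSq_whitenedKer_lt_top (ht : 0 < t) :
    ∫⁻ x, hsNormSq (whitenedKer hK ν t x) ∂ν < ∞ := by
  calc _ ≤ ∫⁻ _, ENNReal.ofReal (κ ^ 2 / t) ∂ν :=
        lintegral_mono fun x => hsNormSq_whitenedKer_le hK ν ht x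
    _ < ∞ := by simp

theorem inner_resolvent_covOp_nonneg (ht : 0 < t) (x : H') :
    0 ≤ ⟪x, resolvent (covOp hK ν) t (covOp hK ν x)⟫ := by
  rw [inner_resolvent_comp_eq (isPositive_covOp hK ν) ht, inner_covOp_self]
  positivity

theorem effDim_nonneg (ht : 0 < t) : 0 ≤ effDim hK ν t :=
  tsum_nonneg fun i => inner_resolvent_covOp_nonneg hK ν ht (stdBasis H' i)

theorem norm_whitenedKer_apply_le (ht : 0 < t) (x : X) (v : Y) :
    ‖whitenedKer hK ν t x v‖ ≤ √(hsNormSq (whitenedKer hK ν t x)).toReal * ‖v‖ :=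
  norm_apply_le_sqrt_hsNormSq _ (hsNormSq_whitenedKer_ne_top hK ν ht x) v

theorem sqrt_hsNormSq_whitenedKer_le (ht : 0 < t) (x : X) :
    √(hsNormSq (whitenedKer hK ν t x)).toReal ≤ κ / √t := by
  have h : κ / √t = √(κ ^ 2 / t) := by rw [Real.sqrt_div (sq_nonneg κ), Real.sqrt_sq hK.nonneg]
  rw [h]
  exact Real.sqrt_le_sqrt (ENNReal.toReal_le_of_le_ofReal (by positivity)
    (hsNormSq_whitenedKer_le hK ν ht x))

variable [TopologicalSpace.SeparableSpace H']

/-- The Hilbert–Schmidt norm is computed through the adjoint, which sends `e i` to `(W (e i)) x`.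
Integrating gives `‖I_ν W (e i)‖ ^ 2`, a diagonal entry of `(T_ν + t I)⁻¹ T_ν`. -/
theorem lintegral_hsNormSq_whitenedKer (ht : 0 < t) :
    ∫⁻ x, hsNormSq (whitenedKer hK ν t x) ∂ν = ∑' i, ENNReal.ofReal
      ⟪stdBasis H' i, resolvent (covOp hK ν) t (covOp hK ν (stdBasis H' i))⟫ := by
  have hT := isPositive_covOp hK ν
  have hc : Countable (stdIndex H') := (stdBasis H').countable_of_separable
  set W := whitening (covOp hK ν) t with hW
  have h1 : ∀ x : X, hsNormSq (whitenedKer hK ν t x) =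
      ∑' i, ENNReal.ofReal (‖(W (stdBasis H' i)) x‖ ^ 2) := by
    intro x
    rw [← hsNormSq_adjoint, hsNormSq]
    refine tsum_congr fun i => ?_
    have h2 : (whitenedKer hK ν t x).adjoint (stdBasis H' i) = (W (stdBasis H' i)) x := by
      refine ext_inner_right ℝ fun v => ?_
      rw [ContinuousLinearMap.adjoint_inner_left, ← RKHS.inner_kerFun]
      exact (inner_whitening_comm hT ht _ _).symm
    rw [h2]
  have hm : ∀ i, AEMeasurable (fun x => ENNReal.ofReal (‖(W (stdBasis H' i)) x‖ ^ 2)) ν := fun i =>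
    (ENNReal.measurable_ofReal.comp ((measurable_apply hK _).norm.pow_const 2)).aemeasurable
  simp_rw [h1]
  rw [lintegral_tsum hm]
  refine tsum_congr fun i => ?_
  rw [lintegral_norm_sq_apply hK ν, ← inner_covOp_self, inner_resolvent_comp_eq hT ht]

/-- The pointwise bound `κ ^ 2 / t` makes the integral finite. Hence the series defining the
effective dimension converges, and its `tsum` is not the default value `0`. -/
theorem summable_effDim (ht : 0 < t) : Summable fun i : stdIndex H' =>
    ⟪stdBasis H' i, resolvent (covOp hK ν) t (covOp hK ν (stdBasis H' i))⟫ := by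
  have h := lintegral_hsNormSq_whitenedKer_lt_top hK ν ht
  rw [lintegral_hsNormSq_whitenedKer hK ν ht] at h
  refine (ENNReal.summable_toReal h.ne).congr fun i => ?_
  exact ENNReal.toReal_ofReal (inner_resolvent_covOp_nonneg hK ν ht _)

theorem lintegral_hsNormSq_whitenedKer_eq (ht : 0 < t) :
    ∫⁻ x, hsNormSq (whitenedKer hK ν t x) ∂ν = ENNReal.ofReal (effDim hK ν t) := by
  rw [lintegral_hsNormSq_whitenedKer hK ν ht, effDim_eq,
    ENNReal.ofReal_tsum_of_nonneg (fun i => inner_resolvent_covOp_nonneg hK ν ht _)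
      (summable_effDim hK ν ht)]

theorem effDim_anti {s : ℝ} (hs : 0 < s) (hst : s ≤ t) : effDim hK ν t ≤ effDim hK ν s := by
  rw [effDim_eq, effDim_eq]
  exact (summable_effDim hK ν (hs.trans_le hst)).tsum_le_tsum
    (fun i => inner_resolvent_comp_anti (isPositive_covOp hK ν) hs hst _) (summable_effDim hK ν hs)

end EffectiveDimension

end HilbertScale

/-! ### Concentration of the whitened noise and of the whitened empirical covariance. -/

namespace HilbertScale

/-- The power series starts at degree two, so every term gains at least `c ^ 2`. This rescales the
noise condition from `‖ε‖ / M` to smaller multiples and yields a variance factor. -/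
theorem exp_mul_sub_sub_one_le {c s : ℝ} (hc0 : 0 ≤ c) (hc1 : c ≤ 1) (hs : 0 ≤ s) :
    Real.exp (c * s) - c * s - 1 ≤ c ^ 2 * (Real.exp s - s - 1) := by
  have key : ∀ y : ℝ, HasSum (fun n : ℕ => y ^ (n + 2) / (n + 2).factorial)
      (Real.exp y - y - 1) := by
    intro y
    have h := NormedSpace.expSeries_div_hasSum_exp y
    rw [← Real.exp_eq_exp_ℝ] at h
    have h' := (hasSum_nat_add_iff' 2).2 h
    have e : ∑ i ∈ Finset.range 2, y ^ i / (i.factorial : ℝ) = 1 + y := by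
      simp [Finset.sum_range_succ]
    rw [e, ← sub_sub, sub_right_comm] at h'
    exact h'
  refine hasSum_le (fun n => ?_) (key (c * s)) ((key s).mul_left (c ^ 2))
  rw [mul_pow, mul_div_assoc]
  refine mul_le_mul_of_nonneg_right ?_ (by positivity)
  exact pow_le_pow_of_le_one hc0 hc1 (by omega)

theorem exp_sub_sub_one_mono {s s' : ℝ} (hs : 0 ≤ s) (h : s ≤ s') :
    Real.exp s - s - 1 ≤ Real.exp s' - s' - 1 := by
  have h1 := Real.add_one_le_exp (s' - s)
  have h2 : Real.exp s' = Real.exp s * Real.exp (s' - s) := by rw [← Real.exp_add]; ring_nf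
  have h3 := Real.one_le_exp hs
  nlinarith [mul_nonneg (sub_nonneg.2 h3) (sub_nonneg.2 h), mul_le_mul_of_nonneg_left h1
    (Real.exp_pos s).le]

theorem exp_sub_sub_one_le_sq {s : ℝ} (hs : 0 ≤ s) (h : s ≤ 1) : Real.exp s - s - 1 ≤ s ^ 2 := by
  have := exp_mul_sub_sub_one_le hs h zero_le_one
  rw [mul_one] at this
  refine this.trans ?_
  have := Real.exp_one_lt_d9
  nlinarith [sq_nonneg s]

/-- The empirical covariance operator `(1 / m) ∑ i, K_{x i} K_{x i}*`. -/
noncomputable def empCov {X Y : Type*} [NormedAddCommGroup Y] [InnerProductSpace ℝ Y]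
    [CompleteSpace Y] (H' : Type*) [NormedAddCommGroup H'] [InnerProductSpace ℝ H']
    [CompleteSpace H'] [RKHS ℝ H' X Y] {m : ℕ} (z : Fin m → X × Y) : H' →L[ℝ] H' :=
  (1 / (m : ℝ)) • ∑ i, RKHS.kerFun H' (z i).1 ∘L (RKHS.kerFun H' (z i).1).adjoint

section Data

variable {X : Type*} [MeasurableSpace X]
  {Y : Type*} [NormedAddCommGroup Y] [InnerProductSpace ℝ Y] [CompleteSpace Y]
  [TopologicalSpace.SeparableSpace Y] [MeasurableSpace Y] [BorelSpace Y]
  {H' : Type*} [NormedAddCommGroup H'] [InnerProductSpace ℝ H'] [CompleteSpace H']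
  [RKHS ℝ H' X Y] {κ : ℝ}
  (hK : IsBoundedMeasurableKernel H' κ) (ρ : Measure (X × Y)) [IsProbabilityMeasure ρ] {t : ℝ}

theorem inner_whitenedKer (ν : Measure X) [IsProbabilityMeasure ν] (ht : 0 < t) (x : X) (v : Y)
    (g : H') : ⟪g, whitenedKer hK ν t x v⟫ = ⟪(whitening (covOp hK ν) t g) x, v⟫ := by
  rw [← RKHS.inner_kerFun, inner_whitening_comm (isPositive_covOp hK ν) ht]
  rfl

variable [TopologicalSpace.SeparableSpace H']

theorem stronglyMeasurable_whitenedKer (ν : Measure X) [IsProbabilityMeasure ν] (ht : 0 < t)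
    {Ω : Type*} [MeasurableSpace Ω] {x : Ω → X} {v : Ω → Y} (hx : Measurable x)
    (hv : Measurable v) : StronglyMeasurable fun ω => whitenedKer hK ν t (x ω) (v ω) := by
  have : SecondCountableTopology Y := UniformSpace.secondCountable_of_separable Y
  refine stronglyMeasurable_of_inner fun g => ?_
  simp_rw [real_inner_comm g, inner_whitenedKer hK ν ht]
  exact ((measurable_apply hK _).comp hx).inner hv

/-- Concentration of the whitened noise `(T_ν + t I) ^ (-1/2) ∑ i, K_{x i} (y i - a (x i))`. -/
theorem measure_noise_gt_le (ht : 0 < t) (a : H') {M Sig : ℝ} (hM : 0 < M)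
    (h2 : MemLp (fun z : X × Y => z.2) 2 ρ)
    (hmean : ∀ᵐ x ∂ρ.fst, ∫ y, y ∂(condLaw ρ x) = a x)
    (hnoise : ∀ᵐ x ∂ρ.fst,
      ∫⁻ y, ENNReal.ofReal (Real.exp (‖y - a x‖ / M) - ‖y - a x‖ / M - 1) ∂(condLaw ρ x)
        ≤ ENNReal.ofReal (Sig ^ 2 / (2 * M ^ 2)))
    (m : ℕ) {η : ℝ} (hη0 : 0 < η) (hη1 : η < 1) :
    Measure.pi (fun _ : Fin m => ρ)
      {z | 2 * ((κ + 1) * M / √t + √(m * (Sig ^ 2 * effDim hK ρ.fst t))) * Real.log (4 / η) <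
        ‖∑ i, whitenedKer hK ρ.fst t (z i).1 ((z i).2 - a (z i).1)‖} ≤ ENNReal.ofReal (η / 2) := by
  have hsc : SecondCountableTopology Y := UniformSpace.secondCountable_of_separable Y
  have hκ := hK.nonneg
  have hN := effDim_nonneg hK ρ.fst ht
  have hst : 0 < √t := Real.sqrt_pos.2 ht
  have hεm : Measurable fun z : X × Y => z.2 - a z.1 :=
    measurable_snd.sub ((measurable_apply hK a).comp measurable_fst)
  have hεi : Integrable (fun z : X × Y => z.2 - a z.1) ρ := by
    refine (h2.integrable one_le_two).sub ?_
    refine Integrable.of_bound ((measurable_apply hK a).comp measurable_fst).aestronglyMeasurable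
      (κ * ‖a‖) (Eventually.of_forall fun z => norm_apply_le hK a z.1)
  have hξm : StronglyMeasurable fun z : X × Y =>
      whitenedKer hK ρ.fst t z.1 (z.2 - a z.1) :=
    stronglyMeasurable_whitenedKer hK ρ.fst ht measurable_fst hεm
  have hξi : Integrable (fun z : X × Y => whitenedKer hK ρ.fst t z.1 (z.2 - a z.1)) ρ := by
    refine (hεi.norm.const_mul (κ / √t)).mono' hξm.aestronglyMeasurable
      (Eventually.of_forall fun z => ?_)
    exact (norm_whitenedKer_apply_le hK _ ht _ _).trans
      (mul_le_mul_of_nonneg_right (sqrt_hsNormSq_whitenedKer_le hK _ ht _) (norm_nonneg _))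
  -- The bound `b` must be strictly positive, hence `κ + 1` in place of `κ`, which may vanish.
  refine measure_norm_sum_gt_le hξm hξi (fun g => ?_) (by positivity) (by positivity)
    (fun τ hτ hτb => ?_) m hη0 hη1
  · rw [← Measure.integral_condKernel (hξi.const_inner g)]
    refine integral_eq_zero_of_ae ?_
    filter_upwards [hmean, (h2.integrable one_le_two).condKernel_ae] with x hx hyi
    simp only [inner_whitenedKer hK ρ.fst ht, Pi.zero_apply]
    have hx' : ∫ y, y ∂(ρ.condKernel x) = a x := hx
    have hsub : Integrable (fun y => y - a x) (ρ.condKernel x) := hyi.sub (integrable_const _)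
    rw [integral_inner hsub, integral_sub hyi (integrable_const _), hx']
    simp
  · have hFm : Measurable fun z : X × Y => ENNReal.ofReal
        (Real.exp (τ * ‖whitenedKer hK ρ.fst t z.1 (z.2 - a z.1)‖) -
          τ * ‖whitenedKer hK ρ.fst t z.1 (z.2 - a z.1)‖ - 1) := by
      have h := (hξm.norm.measurable).const_mul τ
      exact ENNReal.measurable_ofReal.comp (((Real.measurable_exp.comp h).sub h).sub_const 1)
    rw [← Measure.lintegral_condKernel hFm]
    have hx : ∀ᵐ x ∂ρ.fst, ∫⁻ y, ENNReal.ofReal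
        (Real.exp (τ * ‖whitenedKer hK ρ.fst t x (y - a x)‖) -
          τ * ‖whitenedKer hK ρ.fst t x (y - a x)‖ - 1) ∂(ρ.condKernel x) ≤
        ENNReal.ofReal (τ ^ 2 * Sig ^ 2) * hsNormSq (whitenedKer hK ρ.fst t x) := by
      filter_upwards [hnoise] with x hx
      have hx' : ∫⁻ y, ENNReal.ofReal (Real.exp (‖y - a x‖ / M) - ‖y - a x‖ / M - 1)
        ∂(ρ.condKernel x) ≤ ENNReal.ofReal (Sig ^ 2 / (2 * M ^ 2)) := hx
      have hfin := hsNormSq_whitenedKer_ne_top hK ρ.fst ht x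
      set h := (hsNormSq (whitenedKer hK ρ.fst t x)).toReal with hh
      have hh0 : 0 ≤ h := ENNReal.toReal_nonneg
      have hle : √h ≤ κ / √t := sqrt_hsNormSq_whitenedKer_le hK ρ.fst ht x
      -- The factor for which `τ ‖whitenedKer (y - a x)‖ ≤ c (‖y - a x‖ / M)`. The restriction on
      -- `τ` makes `c ≤ 1`, so `c ^ 2` can be pulled out of the noise condition.
      set c := τ * √h * M with hc
      have hc0 : 0 ≤ c := by positivity
      have hc1 : c ≤ 1 := by
        refine le_trans ?_ hτb
        rw [hc, mul_assoc]
        refine mul_le_mul_of_nonneg_left ?_ hτ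
        calc √h * M ≤ κ / √t * M := by gcongr
          _ = κ * M / √t := by ring
          _ ≤ (κ + 1) * M / √t := by gcongr; linarith
      calc _ ≤ ∫⁻ y, ENNReal.ofReal (c ^ 2) * ENNReal.ofReal
            (Real.exp (‖y - a x‖ / M) - ‖y - a x‖ / M - 1) ∂(ρ.condKernel x) := by
            refine lintegral_mono fun y => ?_
            rw [← ENNReal.ofReal_mul (sq_nonneg c)]
            refine ENNReal.ofReal_le_ofReal ?_
            refine le_trans ?_ (exp_mul_sub_sub_one_le hc0 hc1 (by positivity))
            refine exp_sub_sub_one_mono (by positivity) ?_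
            have e : c * (‖y - a x‖ / M) = τ * (√h * ‖y - a x‖) := by
              rw [hc]; field_simp
            rw [e]
            exact mul_le_mul_of_nonneg_left (norm_whitenedKer_apply_le hK _ ht _ _) hτ
        _ = ENNReal.ofReal (c ^ 2) * ∫⁻ y, ENNReal.ofReal
            (Real.exp (‖y - a x‖ / M) - ‖y - a x‖ / M - 1) ∂(ρ.condKernel x) :=
            lintegral_const_mul' _ _ ENNReal.ofReal_ne_top
        _ ≤ ENNReal.ofReal (c ^ 2) * ENNReal.ofReal (Sig ^ 2 / (2 * M ^ 2)) := by gcongr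
        _ ≤ ENNReal.ofReal (τ ^ 2 * Sig ^ 2) * ENNReal.ofReal h := by
            rw [← ENNReal.ofReal_mul (sq_nonneg c), ← ENNReal.ofReal_mul (by positivity)]
            refine ENNReal.ofReal_le_ofReal ?_
            have e : c ^ 2 * (Sig ^ 2 / (2 * M ^ 2)) = τ ^ 2 * Sig ^ 2 * h / 2 := by
              rw [hc, mul_pow, mul_pow, Real.sq_sqrt hh0]; field_simp
            rw [e]
            have : 0 ≤ τ ^ 2 * Sig ^ 2 * h := by positivity
            linarith
        _ = _ := by rw [hh, ENNReal.ofReal_toReal hfin]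
    calc _ ≤ ∫⁻ x, ENNReal.ofReal (τ ^ 2 * Sig ^ 2) * hsNormSq (whitenedKer hK ρ.fst t x) ∂ρ.fst :=
          lintegral_mono_ae hx
      _ = _ := by
          rw [lintegral_const_mul' _ _ ENNReal.ofReal_ne_top,
            lintegral_hsNormSq_whitenedKer_eq hK ρ.fst ht, ← ENNReal.ofReal_mul (by positivity),
            mul_assoc]

/-- `ζ x` is the family of columns of `(T_ν + t I) ^ (-1/2) K_x K_x*`. The factor `K_x*` costs at
most `κ`, and what remains is the whitened kernel, whose second moment is the effective dimension.
-/
theorem exists_lp_whitenedKer (ν : Measure X) [IsProbabilityMeasure ν] (ht : 0 < t) :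
    ∃ ζ : X → lp (fun _ : stdIndex H' => H') 2, StronglyMeasurable ζ ∧
      (∀ x i, ζ x i = whitenedKer hK ν t x ((stdBasis H' i) x)) ∧
      (∀ x, ‖ζ x‖ ≤ κ ^ 2 / √t) ∧
      ∫⁻ x, ENNReal.ofReal (‖ζ x‖ ^ 2) ∂ν ≤ ENNReal.ofReal (κ ^ 2 * effDim hK ν t) := by
  have hc : Countable (stdIndex H') := (stdBasis H').countable_of_separable
  have hκ := hK.nonneg
  let S : X → H' →L[ℝ] H' := fun x => whitenedKer hK ν t x ∘L (RKHS.kerFun H' x).adjoint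
  have hS : ∀ x, hsNormSq (S x) ≤
      ENNReal.ofReal (κ ^ 2) * hsNormSq (whitenedKer hK ν t x) := by
    intro x
    refine (hsNormSq_comp_le' _ _).trans ?_
    gcongr
    rw [LinearIsometryEquiv.norm_map]
    exact norm_kerFun_le hK x
  have hS2 : ∀ x, hsNormSq (S x) ≤ ENNReal.ofReal ((κ ^ 2 / √t) ^ 2) := by
    intro x
    refine (hS x).trans ((mul_le_mul_right (hsNormSq_whitenedKer_le hK ν ht x) _).trans_eq ?_)
    rw [← ENNReal.ofReal_mul (by positivity), div_pow, Real.sq_sqrt ht.le]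
    congr 1; ring
  have hSi : ∀ x i, S x (stdBasis H' i) = whitenedKer hK ν t x ((stdBasis H' i) x) := by
    intro x i
    change whitenedKer hK ν t x ((RKHS.kerFun H' x).adjoint (stdBasis H' i)) = _
    rw [RKHS.adjoint_kerFun]
  let ζ : X → lp (fun _ : stdIndex H' => H') 2 := fun x =>
    ⟨fun i => S x (stdBasis H' i),
      memℓp_of_hsNormSq (ne_top_of_le_ne_top ENNReal.ofReal_ne_top (hS2 x))⟩
  have hζn : ∀ x, ENNReal.ofReal (‖ζ x‖ ^ 2) = hsNormSq (S x) := fun x => ofReal_norm_sq_lp _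
  refine ⟨ζ, stronglyMeasurable_lp fun i => ?_, fun x i => hSi x i, fun x => ?_, ?_⟩
  · change StronglyMeasurable fun x => S x (stdBasis H' i)
    simp_rw [hSi]
    exact stronglyMeasurable_whitenedKer hK ν ht measurable_id (measurable_apply hK _)
  · have h := hS2 x
    rw [← hζn, ENNReal.ofReal_le_ofReal_iff (by positivity)] at h
    exact (sq_le_sq₀ (norm_nonneg _) (by positivity)).1 h
  · simp_rw [hζn]
    refine (lintegral_mono hS).trans_eq ?_
    rw [lintegral_const_mul' _ _ ENNReal.ofReal_ne_top, lintegral_hsNormSq_whitenedKer_eq hK ν ht,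
      ← ENNReal.ofReal_mul (by positivity)]

/-- Concentration of the whitened empirical covariance operator. -/
theorem exists_covariance_event (ht : 0 < t) (m : ℕ) (hm : 0 < m) {η : ℝ} (hη0 : 0 < η)
    (hη1 : η < 1) :
    ∃ B : Set (Fin m → X × Y), MeasurableSet B ∧
      Measure.pi (fun _ : Fin m => ρ) B ≤ ENNReal.ofReal (η / 2) ∧
      ∀ z ∉ B, ∀ g : H',
        ‖whitening (covOp hK ρ.fst) t (empCov H' z g - covOp hK ρ.fst g)‖ ≤
        1 / m * (2 * (2 * (κ + 1) ^ 2 / √t + √(m * (κ ^ 2 * effDim hK ρ.fst t))) *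
          Real.log (4 / η)) * ‖g‖ := by
  obtain ⟨ζ, hζm, hζi, hζb, hζ2⟩ := exists_lp_whitenedKer hK ρ.fst ht
  have hκ := hK.nonneg
  have hN := effDim_nonneg hK ρ.fst ht
  have hst : 0 < √t := Real.sqrt_pos.2 ht
  have hζint : Integrable ζ ρ.fst :=
    Integrable.of_bound hζm.aestronglyMeasurable _ (Eventually.of_forall hζb)
  set μ := ∫ x, ζ x ∂ρ.fst with hμ
  have hμb : ‖μ‖ ≤ κ ^ 2 / √t := by
    have := norm_integral_le_of_norm_le_const (μ := ρ.fst) (Eventually.of_forall hζb)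
    simpa using this
  have hζcm : StronglyMeasurable fun x => ζ x - μ := hζm.sub stronglyMeasurable_const
  have hζci : Integrable (fun x => ζ x - μ) ρ.fst := hζint.sub (integrable_const _)
  have hξm : StronglyMeasurable fun z : X × Y => ζ z.1 - μ := hζcm.comp_measurable measurable_fst
  have hξi : Integrable (fun z : X × Y => ζ z.1 - μ) ρ := hζci.comp_measurable measurable_fst
  have hsqi : Integrable (fun x => ‖ζ x‖ ^ 2) ρ.fst := by
    refine Integrable.of_bound (hζm.norm.pow 2).aestronglyMeasurable ((κ ^ 2 / √t) ^ 2)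
      (Eventually.of_forall fun x => ?_)
    rw [Real.norm_of_nonneg (sq_nonneg _)]
    exact pow_le_pow_left₀ (norm_nonneg _) (hζb x) 2
  -- Centering does not increase the second moment.
  have hvar : ∫⁻ x, ENNReal.ofReal (‖ζ x - μ‖ ^ 2) ∂ρ.fst ≤
      ENNReal.ofReal (κ ^ 2 * effDim hK ρ.fst t) := by
    refine le_trans ?_ hζ2
    have hin : Integrable (fun x => ⟪μ, ζ x⟫) ρ.fst := hζint.const_inner μ
    have e1 : ∀ x, ‖ζ x - μ‖ ^ 2 = ‖ζ x‖ ^ 2 - 2 * ⟪μ, ζ x⟫ + ‖μ‖ ^ 2 := fun x => by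
      rw [norm_sub_sq_real, real_inner_comm]
    have hi2 : Integrable (fun x => ‖ζ x‖ ^ 2 - 2 * ⟪μ, ζ x⟫) ρ.fst := hsqi.sub (hin.const_mul 2)
    have hi3 : Integrable (fun x => ‖ζ x‖ ^ 2 - 2 * ⟪μ, ζ x⟫ + ‖μ‖ ^ 2) ρ.fst :=
      hi2.add (integrable_const _)
    have e2 : ∫ x, (‖ζ x‖ ^ 2 - 2 * ⟪μ, ζ x⟫ + ‖μ‖ ^ 2) ∂ρ.fst =
        ∫ x, ‖ζ x‖ ^ 2 ∂ρ.fst - ‖μ‖ ^ 2 := by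
      rw [integral_add hi2 (integrable_const _), integral_sub hsqi (hin.const_mul 2),
        integral_const_mul, integral_inner hζint, ← hμ, real_inner_self_eq_norm_sq]
      simp; ring
    rw [← ofReal_integral_eq_lintegral_ofReal hsqi (Eventually.of_forall fun x => sq_nonneg _)]
    simp_rw [e1]
    rw [← ofReal_integral_eq_lintegral_ofReal hi3
      (Eventually.of_forall fun x => (sq_nonneg _).trans_eq (e1 x)), e2]
    exact ENNReal.ofReal_le_ofReal (by nlinarith [sq_nonneg ‖μ‖])
  -- The mean is the column family of `(T_ν + t I) ^ (-1/2) T_ν`; evaluation of a coordinate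
  -- commutes with the Bochner integral.
  have hcoord : ∀ i, μ i = whitening (covOp hK ρ.fst) t (covOp hK ρ.fst (stdBasis H' i)) := by
    intro i
    have h1 := (lp.evalCLM ℝ (fun _ : stdIndex H' => H') 2 i).integral_comp_comm hζint
    have h2 : ∫ x, ζ x i ∂ρ.fst = μ i := h1
    have h3 : Integrable (fun x => ζ x i) ρ.fst :=
      (lp.evalCLM ℝ (fun _ : stdIndex H' => H') 2 i).integrable_comp hζint
    rw [← h2]
    refine ext_inner_left ℝ fun g => ?_
    rw [← integral_inner h3, ← inner_whitening_comm (isPositive_covOp hK _) ht, real_inner_comm,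
      inner_covOp, inner_embL2]
    refine integral_congr_ae (Eventually.of_forall fun x => ?_)
    simp only [hζi, inner_whitenedKer hK ρ.fst ht]
    rw [real_inner_comm]
  set r := 2 * (2 * (κ + 1) ^ 2 / √t + √(m * (κ ^ 2 * effDim hK ρ.fst t))) * Real.log (4 / η)
    with hr
  refine ⟨{z | r < ‖∑ i, (ζ (z i).1 - μ)‖},
    measurableSet_lt measurable_const (stronglyMeasurable_sum_pi hξm m).norm.measurable, ?_, ?_⟩
  · refine measure_norm_sum_gt_le hξm hξi (fun g => ?_) (by positivity) (by positivity)
      (fun τ hτ hτb => ?_) m hη0 hη1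
    · rw [integral_inner hξi]
      have h1 : ∫ z : X × Y, (ζ z.1 - μ) ∂ρ = ∫ x, (ζ x - μ) ∂ρ.fst :=
        (integral_map (μ := ρ) measurable_fst.aemeasurable
          (f := fun x => ζ x - μ) hζcm.aestronglyMeasurable).symm
      rw [h1, integral_sub hζint (integrable_const _)]
      simp [hμ]
    · have hFm : Measurable fun x : X => ENNReal.ofReal
          (Real.exp (τ * ‖ζ x - μ‖) - τ * ‖ζ x - μ‖ - 1) := by
        have h := (hζcm.norm.measurable).const_mul τ
        exact ENNReal.measurable_ofReal.comp (((Real.measurable_exp.comp h).sub h).sub_const 1)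
      have h1 : ∫⁻ z : X × Y, ENNReal.ofReal
          (Real.exp (τ * ‖ζ z.1 - μ‖) - τ * ‖ζ z.1 - μ‖ - 1) ∂ρ = ∫⁻ x, ENNReal.ofReal
          (Real.exp (τ * ‖ζ x - μ‖) - τ * ‖ζ x - μ‖ - 1) ∂ρ.fst :=
        (lintegral_map hFm measurable_fst).symm
      rw [h1]
      calc _ ≤ ∫⁻ x, ENNReal.ofReal (τ ^ 2) * ENNReal.ofReal (‖ζ x - μ‖ ^ 2) ∂ρ.fst := by
            refine lintegral_mono fun x => ?_
            rw [← ENNReal.ofReal_mul (sq_nonneg τ), ← mul_pow]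
            refine ENNReal.ofReal_le_ofReal (exp_sub_sub_one_le_sq (by positivity) ?_)
            refine le_trans (mul_le_mul_of_nonneg_left ?_ hτ) hτb
            calc ‖ζ x - μ‖ ≤ ‖ζ x‖ + ‖μ‖ := norm_sub_le _ _
              _ ≤ κ ^ 2 / √t + κ ^ 2 / √t := add_le_add (hζb x) hμb
              _ = 2 * κ ^ 2 / √t := by ring
              _ ≤ 2 * (κ + 1) ^ 2 / √t := by gcongr; linarith
        _ = ENNReal.ofReal (τ ^ 2) * ∫⁻ x, ENNReal.ofReal (‖ζ x - μ‖ ^ 2) ∂ρ.fst :=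
            lintegral_const_mul' _ _ ENNReal.ofReal_ne_top
        _ ≤ _ := by
            rw [ENNReal.ofReal_mul (sq_nonneg τ)]
            gcongr
  · intro z hz g
    have hz' : ‖∑ i, (ζ (z i).1 - μ)‖ ≤ r := not_lt.1 hz
    have hm' : (m : ℝ) ≠ 0 := by positivity
    -- The event was fixed without reference to `g`, so the bound may later be used with a `g` that
    -- depends on the sample.
    have hU := norm_apply_le_lp
      (S := whitening (covOp hK ρ.fst) t ∘L (empCov H' z - covOp hK ρ.fst))
      (a := (1 / (m : ℝ)) • ∑ i, (ζ (z i).1 - μ)) (fun i => ?_) g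
    · refine hU.trans ?_
      rw [norm_smul, Real.norm_of_nonneg (by positivity)]
      gcongr
    · have h1 : ((1 / (m : ℝ)) • ∑ k, (ζ (z k).1 - μ) : lp (fun _ : stdIndex H' => H') 2) i =
          (1 / (m : ℝ)) • ∑ k, (ζ (z k).1 i - μ i) := by
        rw [lp.coeFn_smul, Pi.smul_apply, lp.coeFn_sum, Finset.sum_apply]
        rfl
      rw [h1, Finset.sum_sub_distrib, Finset.sum_const, Finset.card_univ, Fintype.card_fin,
        hcoord, ContinuousLinearMap.comp_apply, sub_apply, map_sub, smul_sub,
        ← Nat.cast_smul_eq_nsmul ℝ, smul_smul, one_div_mul_cancel hm', one_smul]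
      congr 1
      simp only [hζi, empCov, smul_apply, sum_apply,
        map_smul, map_sum, ContinuousLinearMap.comp_apply, RKHS.adjoint_kerFun]
      rfl

end Data

end HilbertScale

namespace HilbertScale

/-! ### Real inequalities that produce the exponents and the constants. -/

section RealInequalities

/-- Either `Z ≤ 2 x`, or the linear term takes at most half of `Z ^ 2`, leaving `Z ^ (2 - k) ≤ 2 y`.
-/
theorem le_of_sq_le_mul_add_mul_rpow {Z x y k : ℝ} (hZ : 0 ≤ Z) (hx : 0 ≤ x) (hy : 0 ≤ y)
    (hk : k < 2) (h : Z ^ 2 ≤ x * Z + y * Z ^ k) : Z ≤ 2 * x + (2 * y) ^ (1 / (2 - k)) := by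
  rcases hZ.eq_or_lt with rfl | hZ
  · positivity
  have hk' : 0 < 2 - k := by linarith
  by_cases h1 : Z ≤ 2 * x
  · have : 0 ≤ (2 * y) ^ (1 / (2 - k)) := by positivity
    linarith
  · have h2 : Z ^ 2 ≤ 2 * y * Z ^ k := by nlinarith [not_le.1 h1]
    have h3 : Z ^ (2 - k) ≤ 2 * y := by
      rw [Real.rpow_sub hZ, Real.rpow_two, div_le_iff₀ (Real.rpow_pos_of_pos hZ k)]
      exact h2
    have h4 := Real.rpow_le_rpow (Real.rpow_nonneg hZ.le _) h3
      (show (0 : ℝ) ≤ 1 / (2 - k) by positivity)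
    rw [← Real.rpow_mul hZ.le, mul_one_div_cancel hk'.ne', Real.rpow_one] at h4
    linarith

variable {p q s α u : ℝ}

/-- The denominator equals `2 (p + s - q (s - 1))`. -/
theorem exponent_denominator_pos (hqs : q * (s - 1) < p + s) :
    0 < 2 * (p + q) - 2 * s * (q - 1) := by nlinarith

theorem exponent_eq (hp : 0 ≤ p) (hqs : q * (s - 1) < p + s)
    (hu : u = (p + q) / (2 * (p + q) - 2 * s * (q - 1))) :
    (2 * u * (s + p) - p) / (2 * (p + 1)) = s * q / (2 * (p + q) - 2 * s * (q - 1)) := by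
  have h := exponent_denominator_pos hqs
  have hp1 : p + 1 ≠ 0 := by positivity
  have hu' : u * (2 * (p + q) - 2 * s * (q - 1)) = p + q := by
    rw [hu, div_mul_cancel₀ _ h.ne']
  rw [div_eq_div_iff (by positivity) h.ne']
  linear_combination 2 * (s + p) * hu'

/-- Error bound in the energy norm `√(b² + t e²)`. -/
theorem sqrt_energy_le (hp : 0 ≤ p) (hq : 1 ≤ q) (hqp : q ≤ 2 + p) (hs : 0 < s)
    (hqs : q * (s - 1) < p + s) (hα : 0 < α)
    (hu : u = (p + q) / (2 * (p + q) - 2 * s * (q - 1)))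
    {b e n t Λ c R : ℝ} (hb : 0 ≤ b) (he : 0 ≤ e) (hn0 : 0 ≤ n) (hn : n ≤ α * b ^ s) (ht : 0 < t)
    (hΛ : 1 ≤ Λ) (hc : 0 ≤ c) (hR : 0 ≤ R)
    (h : b ^ 2 + t * e ^ 2 ≤ c * (t ^ u * Λ) * √(b ^ 2 + t * e ^ 2) +
      2 * t * (R * (n ^ ((q - 1) / (p + 1)) * e ^ (1 - (q - 1) / (p + 1))))) :
    √(b ^ 2 + t * e ^ 2) ≤ (2 * c + (4 * R * α ^ ((q - 1) / (p + 1))) ^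
      ((p + 1) / (p + q - s * (q - 1)))) * (t ^ u * Λ) := by
  have hp1 : 0 < p + 1 := by linarith
  set a := (q - 1) / (p + 1) with ha
  have ha0 : 0 ≤ a := by rw [ha]; exact div_nonneg (by linarith) hp1.le
  have ha1 : a ≤ 1 := by rw [ha, div_le_one hp1]; linarith
  have hnn : 0 ≤ b ^ 2 + t * e ^ 2 := by positivity
  set Z := √(b ^ 2 + t * e ^ 2) with hZ
  have hZ0 : 0 ≤ Z := Real.sqrt_nonneg _
  have hZ2 : Z ^ 2 = b ^ 2 + t * e ^ 2 := Real.sq_sqrt hnn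
  have hbZ : b ≤ Z := Real.le_sqrt_of_sq_le (by nlinarith [mul_nonneg ht.le (sq_nonneg e)])
  have heZ : √t * e ≤ Z := Real.le_sqrt_of_sq_le (by
    rw [mul_pow, Real.sq_sqrt ht.le]; nlinarith [sq_nonneg b])
  have hden : 0 < p + q - s * (q - 1) := by have := exponent_denominator_pos hqs; linarith
  -- The total power of `Z` in the source term: `n ^ a` contributes `s a` by conditional stability,
  -- and `e ^ (1 - a)` contributes `1 - a`. The hypothesis on `q (s - 1)` is equivalent to `k < 2`.
  set k := s * a + (1 - a) with hk
  have h2k : 2 - k = (p + q - s * (q - 1)) / (p + 1) := by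
    rw [hk, ha]; field_simp; ring
  have hk2 : k < 2 := by
    have : 0 < 2 - k := by rw [h2k]; positivity
    linarith
  have hna : n ^ a ≤ α ^ a * Z ^ (s * a) := by
    calc n ^ a ≤ (α * Z ^ s) ^ a := by
          refine Real.rpow_le_rpow hn0 (hn.trans ?_) ha0
          gcongr
      _ = α ^ a * Z ^ (s * a) := by
          rw [Real.mul_rpow hα.le (by positivity), ← Real.rpow_mul hZ0]
  -- The part `t ^ ((1 - a) / 2)` is spent on turning `e` into `√t e ≤ Z`; the power `(1 + a) / 2`
  -- of `t` survives.
  have hea : t * e ^ (1 - a) ≤ t ^ ((1 + a) / 2) * Z ^ (1 - a) := by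
    have h1 : t = t ^ ((1 + a) / 2) * t ^ ((1 / 2) * (1 - a)) := by
      rw [← Real.rpow_add ht]
      have : (1 + a) / 2 + 1 / 2 * (1 - a) = 1 := by ring
      rw [this, Real.rpow_one]
    have h2 : t ^ ((1 / 2) * (1 - a)) * e ^ (1 - a) = (√t * e) ^ (1 - a) := by
      rw [Real.mul_rpow (Real.sqrt_nonneg t) he, Real.sqrt_eq_rpow, ← Real.rpow_mul ht.le]
    calc t * e ^ (1 - a) = t ^ ((1 + a) / 2) * (t ^ ((1 / 2) * (1 - a)) * e ^ (1 - a)) := by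
          rw [← mul_assoc, ← h1]
      _ ≤ t ^ ((1 + a) / 2) * Z ^ (1 - a) := by
          rw [h2]
          gcongr
  have hmain : Z ^ 2 ≤ c * (t ^ u * Λ) * Z + 2 * R * α ^ a * t ^ ((1 + a) / 2) * Z ^ k := by
    rw [hZ2]
    refine h.trans (add_le_add_right ?_ _)
    calc 2 * t * (R * (n ^ a * e ^ (1 - a))) = 2 * R * (n ^ a * (t * e ^ (1 - a))) := by ring
      _ ≤ 2 * R * ((α ^ a * Z ^ (s * a)) * (t ^ ((1 + a) / 2) * Z ^ (1 - a))) := by gcongr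
      _ = 2 * R * α ^ a * t ^ ((1 + a) / 2) * (Z ^ (s * a) * Z ^ (1 - a)) := by ring
      _ = _ := by
          rw [← Real.rpow_add_of_nonneg hZ0 (by positivity) (by linarith)]
  have hres := le_of_sq_le_mul_add_mul_rpow hZ0 (by positivity) (by positivity) hk2 hmain
  have hexp : (2 * (2 * R * α ^ a * t ^ ((1 + a) / 2))) ^ (1 / (2 - k)) =
      (4 * R * α ^ a) ^ ((p + 1) / (p + q - s * (q - 1))) * t ^ u := by
    have e1 : 2 * (2 * R * α ^ a * t ^ ((1 + a) / 2)) = 4 * R * α ^ a * t ^ ((1 + a) / 2) := by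
      ring
    have e2 : 1 / (2 - k) = (p + 1) / (p + q - s * (q - 1)) := by rw [h2k, one_div_div]
    -- The origin of `u`: it is the surviving power `(1 + a) / 2` divided by `2 - k`.
    have e3 : (1 + a) / 2 * ((p + 1) / (p + q - s * (q - 1))) = u := by
      rw [hu, ha]
      have : 2 * (p + q) - 2 * s * (q - 1) = 2 * (p + q - s * (q - 1)) := by ring
      rw [this]
      field_simp
      ring
    rw [e1, e2, Real.mul_rpow (by positivity) (by positivity), ← Real.rpow_mul ht.le, e3]
  rw [hexp] at hres
  refine hres.trans ?_
  have htu : 0 ≤ t ^ u := by positivity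
  have hX : 0 ≤ (4 * R * α ^ a) ^ ((p + 1) / (p + q - s * (q - 1))) * t ^ u := by positivity
  nlinarith [mul_le_mul_of_nonneg_left hΛ hX]

/-- Interpolation of the energy bound. -/
theorem interpolated_error_le (hp : 0 ≤ p) (hs : 0 < s) (hα : 0 < α)
    {b e n t Λ c : ℝ} (hb : 0 ≤ b) (he : 0 ≤ e) (hn0 : 0 ≤ n) (hn : n ≤ α * b ^ s) (ht : 0 < t)
    (hΛ : 1 ≤ Λ) (hc : 0 ≤ c) (h : √(b ^ 2 + t * e ^ 2) ≤ c * (t ^ u * Λ)) :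
    n ^ (1 / (p + 1)) * e ^ (1 - 1 / (p + 1)) ≤
      α ^ (1 / (p + 1)) * c ^ ((p + s) / (p + 1)) * t ^ ((2 * u * (s + p) - p) / (2 * (p + 1))) *
        Λ ^ max 1 ((p + s) / (p + 1)) := by
  have hp1 : 0 < p + 1 := by linarith
  have hp1' : 1 - 1 / (p + 1) = p / (p + 1) := by field_simp; ring
  have hbZ : b ≤ c * (t ^ u * Λ) := (Real.le_sqrt_of_sq_le (by
    nlinarith [mul_nonneg ht.le (sq_nonneg e)])).trans h
  have heZ : √t * e ≤ c * (t ^ u * Λ) := (Real.le_sqrt_of_sq_le (by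
    rw [mul_pow, Real.sq_sqrt ht.le]; nlinarith [sq_nonneg b])).trans h
  have hΛ0 : 0 < Λ := by linarith
  set Z := c * (t ^ u * Λ) with hZ
  have hZ0 : 0 ≤ Z := by positivity
  have he' : e ≤ t ^ (-(1 / 2) : ℝ) * Z := by
    rw [Real.rpow_neg ht.le, ← Real.sqrt_eq_rpow, inv_mul_eq_div, le_div_iff₀ (by positivity),
      mul_comm]
    exact heZ
  have h1 : n ^ (1 / (p + 1)) ≤ α ^ (1 / (p + 1)) * Z ^ (s / (p + 1)) := by
    calc n ^ (1 / (p + 1)) ≤ (α * Z ^ s) ^ (1 / (p + 1)) := by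
          refine Real.rpow_le_rpow hn0 (hn.trans ?_) (by positivity)
          gcongr
      _ = _ := by
          rw [Real.mul_rpow hα.le (by positivity), ← Real.rpow_mul hZ0, mul_one_div]
  have h2 : e ^ (p / (p + 1)) ≤ t ^ (-(p / (2 * (p + 1)))) * Z ^ (p / (p + 1)) := by
    calc e ^ (p / (p + 1)) ≤ (t ^ (-(1 / 2) : ℝ) * Z) ^ (p / (p + 1)) :=
          Real.rpow_le_rpow he he' (by positivity)
      _ = _ := by
          rw [Real.mul_rpow (by positivity) hZ0, ← Real.rpow_mul ht.le]
          congr 2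
          field_simp
  have h3 : Z ^ (s / (p + 1)) * Z ^ (p / (p + 1)) = Z ^ ((p + s) / (p + 1)) := by
    rw [← Real.rpow_add_of_nonneg hZ0 (by positivity) (by positivity), ← add_div, add_comm s p]
  have h4 : Z ^ ((p + s) / (p + 1)) = c ^ ((p + s) / (p + 1)) *
      (t ^ (u * ((p + s) / (p + 1))) * Λ ^ ((p + s) / (p + 1))) := by
    rw [hZ, Real.mul_rpow hc (by positivity), Real.mul_rpow (by positivity) hΛ0.le,
      ← Real.rpow_mul ht.le]
  have h5 : t ^ (-(p / (2 * (p + 1)))) * t ^ (u * ((p + s) / (p + 1))) =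
      t ^ ((2 * u * (s + p) - p) / (2 * (p + 1))) := by
    rw [← Real.rpow_add ht]
    congr 1
    field_simp
    ring
  rw [hp1']
  calc n ^ (1 / (p + 1)) * e ^ (p / (p + 1))
      ≤ (α ^ (1 / (p + 1)) * Z ^ (s / (p + 1))) *
        (t ^ (-(p / (2 * (p + 1)))) * Z ^ (p / (p + 1))) := by gcongr
    _ = α ^ (1 / (p + 1)) * t ^ (-(p / (2 * (p + 1)))) *
        (Z ^ (s / (p + 1)) * Z ^ (p / (p + 1))) := by ring
    _ = α ^ (1 / (p + 1)) * c ^ ((p + s) / (p + 1)) *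
        (t ^ (-(p / (2 * (p + 1)))) * t ^ (u * ((p + s) / (p + 1)))) *
        Λ ^ ((p + s) / (p + 1)) := by rw [h3, h4]; ring
    _ ≤ _ := by
        rw [h5]
        gcongr
        exact le_max_right _ _

/-- The deviation bounds at the regularization parameter `t` with `t ^ u / √N = 1 / √m`. -/
theorem deviation_le {N N₁ t Λ β v : ℝ} {m : ℕ} (hN₁ : 0 < N₁) (hN : N₁ ≤ N) (ht : 0 < t)
    (hm : 0 < m) (hNm : N ≤ m * t) (hθ : t ^ u / √N = 1 / √(m : ℝ)) (hβ : 0 ≤ β) (hv : 0 ≤ v)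
    (hΛ : 0 ≤ Λ) :
    1 / m * (2 * (β / √t + √(m * (v ^ 2 * N))) * Λ) ≤ 2 * (β / N₁ + v) * (t ^ u * Λ) := by
  have hm' : (0 : ℝ) < m := by exact_mod_cast hm
  have hN0 : 0 < N := hN₁.trans_le hN
  set n := √N with hn
  set a := √(m : ℝ) with ha
  set l := √t with hl
  have hn0 : 0 < n := Real.sqrt_pos.2 hN0
  have ha0 : 0 < a := Real.sqrt_pos.2 hm'
  have hl0 : 0 < l := Real.sqrt_pos.2 ht
  have hn2 : n ^ 2 = N := Real.sq_sqrt hN0.le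
  have ha2 : a ^ 2 = m := Real.sq_sqrt hm'.le
  -- The parameter choice equates the standard deviation `√(N / m)` with `t ^ u`.
  have hna : n = t ^ u * a := by
    rw [div_eq_div_iff hn0.ne' ha0.ne'] at hθ
    linarith
  have hnal : n ≤ a * l := by
    rw [ha, hl, ← Real.sqrt_mul hm'.le]
    exact Real.sqrt_le_sqrt hNm
  have hsq : √(m * (v ^ 2 * N)) = a * (v * n) := by
    rw [Real.sqrt_mul hm'.le, Real.sqrt_mul (sq_nonneg v), Real.sqrt_sq hv]
  have htu : 0 < t ^ u := Real.rpow_pos_of_pos ht u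
  -- The boundedness term is no worse than the variance term: `t ^ u m √t = √N √(m t) ≥ N ≥ N₁` by
  -- `N ≤ m t`.
  have h1 : β / (m * l) ≤ β / N₁ * t ^ u := by
    have e : N₁ ≤ t ^ u * (m * l) := by
      have e1 : t ^ u * (m * l) = n * (a * l) := by rw [hna, ← ha2]; ring
      rw [e1]
      nlinarith [mul_le_mul_of_nonneg_left hnal hn0.le]
    rw [div_mul_eq_mul_div, div_le_div_iff₀ (by positivity) hN₁]
    calc β * N₁ ≤ β * (t ^ u * (m * l)) := by gcongr
      _ = _ := by ring
  have h2 : 1 / m * (a * (v * n)) = v * t ^ u := by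
    rw [hna, ← ha2]; field_simp
  calc 1 / m * (2 * (β / l + √(m * (v ^ 2 * N))) * Λ)
      = 2 * (β / (m * l) + 1 / m * (a * (v * n))) * Λ := by
        rw [hsq]; field_simp
    _ ≤ 2 * (β / N₁ * t ^ u + v * t ^ u) * Λ := by rw [h2]; gcongr
    _ = _ := by ring

end RealInequalities

/-! ### Negative powers of the generator of the scale. -/

section Scale

variable {H : Type*} [NormedAddCommGroup H] [InnerProductSpace ℝ H] [CompleteSpace H]
  {L : H →ₗ.[ℝ] H} {c : ℝ}

theorem invOp_apply (hL : IsScaleGenerator L c) (f : L.domain) : invOp L (L f) = f := by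
  have h := hL.bound (⟨invOp L (L f), invOp_mem_domain hL (L f)⟩ - f)
  rw [LinearPMap.map_sub, apply_invOp hL, sub_self, norm_zero] at h
  have h1 : ‖invOp L (L f) - (f : H)‖ ≤ 0 :=
    nonpos_of_mul_nonpos_right h hL.const_pos
  exact sub_eq_zero.1 (norm_le_zero_iff.1 h1)

theorem isPositive_invOp (hL : IsScaleGenerator L c) : (invOp L).IsPositive := by
  have hsym : ∀ f g : L.domain, ⟪L f, (g : H)⟫ = ⟪(f : H), L g⟫ := by
    have h := LinearPMap.adjoint_isFormalAdjoint hL.selfAdjoint.dense_domain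
    have hsa : LinearPMap.adjoint L = L := hL.selfAdjoint
    rw [hsa] at h
    intro f g
    exact h f g
  refine ⟨fun x y => ?_, fun x => ?_⟩
  · have h := hsym ⟨invOp L x, invOp_mem_domain hL x⟩ ⟨invOp L y, invOp_mem_domain hL y⟩
    rw [apply_invOp hL, apply_invOp hL] at h
    exact h.symm
  · change 0 ≤ ⟪invOp L x, x⟫
    by_cases h0 : invOp L x = 0
    · rw [h0, inner_zero_left]
    · have h := hL.pos ⟨invOp L x, invOp_mem_domain hL x⟩ h0
      rw [apply_invOp hL, real_inner_comm] at h
      exact h.le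

theorem negPower_add (hL : IsScaleGenerator L c) {a b : ℝ} (ha : 0 ≤ a) (hb : 0 ≤ b) (x : H) :
    negPower L (a + b) x = negPower L a (negPower L b x) := by
  rw [negPower, opPower_add (isPositive_invOp hL) ha hb]
  rfl

theorem negPower_one (hL : IsScaleGenerator L c) : negPower L 1 = invOp L :=
  opPower_one (isPositive_invOp hL)

theorem negPower_one_apply (hL : IsScaleGenerator L c) (f : L.domain) :
    negPower L 1 (L f) = f := by
  rw [negPower_one hL, invOp_apply hL]

theorem norm_negPower_le (hL : IsScaleGenerator L c) {a b : ℝ} (ha : 0 ≤ a) (hb : 0 < b)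
    (hab : a ≤ b) (x : H) :
    ‖negPower L a x‖ ≤ ‖negPower L b x‖ ^ (a / b) * ‖x‖ ^ (1 - a / b) := by
  have h := norm_opPower_mul_le (isPositive_invOp hL) hb.le (div_nonneg ha hb.le)
    ((div_le_one hb).2 hab) x
  rw [div_mul_cancel₀ _ hb.ne'] at h
  exact h

/-- In terms of `x = L f` all norms of the scale that are needed become norms of bounded powers
applied to `x`, to which the interpolation inequality applies. -/
theorem negNorm_eq (hL : IsScaleGenerator L c) {p : ℝ} (hp : 0 ≤ p) (f : L.domain) :
    negNorm L p f = ‖negPower L (p + 1) (L f)‖ := by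
  rw [negNorm, negPower_add hL hp zero_le_one, negPower_one_apply hL]

/-- Elements with smoothness at least one lie in the domain of `L`. -/
theorem exists_domain_of_source (hL : IsScaleGenerator L c) {q : ℝ} (hq : 1 ≤ q)
    {fhat w : H} {fbar : L.domain} (h : fhat - fbar = negPower L q w) :
    ∃ g : L.domain, (g : H) = fhat ∧ L (g - fbar) = negPower L (q - 1) w := by
  have h1 : negPower L q w = invOp L (negPower L (q - 1) w) := by
    have := negPower_add hL zero_le_one (sub_nonneg.2 hq) w
    rw [add_sub_cancel, negPower_one hL] at this
    exact this
  refine ⟨⟨invOp L (negPower L (q - 1) w), invOp_mem_domain hL _⟩ + fbar, ?_, ?_⟩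
  · change invOp L (negPower L (q - 1) w) + (fbar : H) = fhat
    rw [← h1, ← h, sub_add_cancel]
  · rw [add_sub_cancel_right, apply_invOp hL]

/-- Move the self-adjoint power onto `x` and interpolate it between exponents `0` and `p + 1`. The
condition `q ≤ 2 + p` says that `q - 1` lies in that range. -/
theorem abs_inner_negPower_le (hL : IsScaleGenerator L c) {p q : ℝ} (hp : 0 ≤ p) (hq : 1 ≤ q)
    (hqp : q ≤ 2 + p) (x w : H) {R : ℝ} (hw : ‖w‖ ≤ R) :
    |⟪x, negPower L (q - 1) w⟫| ≤ R * (‖negPower L (p + 1) x‖ ^ ((q - 1) / (p + 1)) *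
      ‖x‖ ^ (1 - (q - 1) / (p + 1))) := by
  have h0 : ⟪negPower L (q - 1) x, w⟫ = ⟪x, negPower L (q - 1) w⟫ :=
    inner_opPower_comm (isPositive_invOp hL) (sub_nonneg.2 hq) x w
  rw [← h0]
  refine (abs_real_inner_le_norm _ _).trans ?_
  rw [mul_comm]
  have h := norm_negPower_le hL (sub_nonneg.2 hq) (by linarith : 0 < p + 1)
    (by linarith : q - 1 ≤ p + 1) x
  exact mul_le_mul hw h (norm_nonneg _) ((norm_nonneg _).trans hw)

end Scale

end HilbertScale

namespace HilbertScale

/-! ### Deterministic inequalities for a given sample. -/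

section Deterministic

variable {X : Type*} {Y : Type*} [NormedAddCommGroup Y] [InnerProductSpace ℝ Y] [CompleteSpace Y]
  {H : Type*} [NormedAddCommGroup H] [InnerProductSpace ℝ H]
  {H' : Type*} [NormedAddCommGroup H'] [InnerProductSpace ℝ H'] [CompleteSpace H']
  [RKHS ℝ H' X Y]

theorem inner_empCov_self {m : ℕ} (z : Fin m → X × Y) (g : H') :
    ⟪empCov H' z g, g⟫ = 1 / (m : ℝ) * ∑ i, ‖g (z i).1‖ ^ 2 := by
  simp only [empCov, smul_apply, sum_apply, ContinuousLinearMap.comp_apply, RKHS.adjoint_kerFun,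
    real_inner_smul_left, sum_inner, RKHS.kerFun_inner, real_inner_self_eq_norm_sq]

/-- The basic inequality satisfied by the minimizers of the Tikhonov functional. -/
theorem basic_inequality {L : H →ₗ.[ℝ] H} {D : Set H} {A : H → H'} {fbar : L.domain} {m : ℕ}
    {z : Fin m → X × Y} {t : ℝ} {f fhat : L.domain} (hf : IsTikhonovMinimizer L D A fbar z t f)
    (hD : (fhat : H) ∈ D) :
    ⟪empCov H' z (A f - A fhat), A f - A fhat⟫ + t * ‖L (f - fhat)‖ ^ 2 ≤
      2 * ⟪A f - A fhat, (1 / (m : ℝ)) • ∑ i, RKHS.kerFun H' (z i).1 ((z i).2 - A fhat (z i).1)⟫ -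
        2 * t * ⟪L (f - fhat), L (fhat - fbar)⟫ := by
  have h := hf.2 fhat hD
  have e1 : ∀ i, ‖A f (z i).1 - (z i).2‖ ^ 2 = ‖(A f - A fhat) (z i).1‖ ^ 2 -
      2 * ⟪(A f - A fhat) (z i).1, (z i).2 - A fhat (z i).1⟫ +
        ‖A fhat (z i).1 - (z i).2‖ ^ 2 := by
    intro i
    rw [← norm_sub_rev (z i).2 (A fhat (z i).1), ← norm_sub_sq_real, RKHS.coe_sub, Pi.sub_apply]
    congr 2
    abel
  have e2 : ‖L (f - fbar)‖ ^ 2 = ‖L (f - fhat)‖ ^ 2 + 2 * ⟪L (f - fhat), L (fhat - fbar)⟫ +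
      ‖L (fhat - fbar)‖ ^ 2 := by
    rw [← norm_add_sq_real, ← LinearPMap.map_add]
    congr 3
    abel
  rw [inner_empCov_self, real_inner_smul_right, inner_sum]
  simp only [RKHS.inner_kerFun]
  simp only [tikhonov, e1, Finset.sum_add_distrib, Finset.sum_sub_distrib, ← Finset.mul_sum] at h
  rw [e2] at h
  linarith

variable [MeasurableSpace X] [TopologicalSpace.SeparableSpace Y] [MeasurableSpace Y]
  [BorelSpace Y] {κ : ℝ}
  (hK : IsBoundedMeasurableKernel H' κ) (ν : Measure X) [IsProbabilityMeasure ν]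

/-- Replacing `T'` by `T_ν` leaves two pairings with `g`, each split into the energy of `g` and a
whitened deviation. The bound `‖g‖ ≤ ℓ e` then turns `t ‖g‖ ^ 2` into part of the energy. -/
theorem energy_le_of_deviation {t : ℝ} (ht : 0 < t) {T' : H' →L[ℝ] H'} {g ζ : H'}
    {δ₁ δ₂ ℓ ℓ₁ e x : ℝ}
    (hδ₁ : ‖whitening (covOp hK ν) t ζ‖ ≤ δ₁)
    (hδ₂ : ‖whitening (covOp hK ν) t (T' g - covOp hK ν g)‖ ≤ δ₂ * ‖g‖) (hδ : 0 ≤ δ₂)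
    (hℓ : 0 ≤ ℓ) (hge : ‖g‖ ≤ ℓ * e) (hg : ‖g‖ ≤ ℓ₁)
    (h : ⟪T' g, g⟫ + t * e ^ 2 ≤ 2 * ⟪g, ζ⟫ + x) :
    ‖embL2 hK ν g‖ ^ 2 + t * e ^ 2 ≤
      (1 + ℓ) * (2 * δ₁ + δ₂ * ℓ₁) * √(‖embL2 hK ν g‖ ^ 2 + t * e ^ 2) + x := by
  have hT := isPositive_covOp hK ν
  set b := ‖embL2 hK ν g‖ with hb
  set Z := √(b ^ 2 + t * e ^ 2) with hZ
  have hZ0 : 0 ≤ Z := Real.sqrt_nonneg _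
  have hZ2 : Z ^ 2 = b ^ 2 + t * e ^ 2 := Real.sq_sqrt (by positivity)
  have hδ₁0 : 0 ≤ δ₁ := (norm_nonneg _).trans hδ₁
  have hD : √(⟪covOp hK ν g, g⟫ + t * ‖g‖ ^ 2) ≤ (1 + ℓ) * Z := by
    refine Real.sqrt_le_iff.2 ⟨by positivity, ?_⟩
    rw [inner_covOp_self, mul_pow, hZ2]
    have h1 : ‖g‖ ^ 2 ≤ ℓ ^ 2 * e ^ 2 := by
      rw [← mul_pow]; exact pow_le_pow_left₀ (norm_nonneg _) hge 2
    have h2 := mul_le_mul_of_nonneg_left h1 ht.le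
    have h3 : 0 ≤ (2 * ℓ + ℓ ^ 2) * b ^ 2 := by positivity
    have h4 : 0 ≤ (1 + 2 * ℓ) * (t * e ^ 2) := by positivity
    nlinarith
  have h1 : ⟪g, ζ⟫ ≤ (1 + ℓ) * Z * δ₁ :=
    (le_abs_self _).trans ((abs_inner_le_whitening hT ht g ζ).trans
      (mul_le_mul hD hδ₁ (norm_nonneg _) (by positivity)))
  have h2 : |⟪g, T' g - covOp hK ν g⟫| ≤ (1 + ℓ) * Z * (δ₂ * ℓ₁) :=
    (abs_inner_le_whitening hT ht g _).trans
      (mul_le_mul hD (hδ₂.trans (by gcongr)) (norm_nonneg _) (by positivity))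
  have h3 : ⟪T' g, g⟫ = ⟪g, T' g - covOp hK ν g⟫ + b ^ 2 := by
    rw [hb, ← inner_covOp_self, inner_sub_right, real_inner_comm, real_inner_comm g (covOp hK ν g)]
    ring
  have h4 := (abs_le.1 h2).1
  rw [h3] at h
  nlinarith

end Deterministic

/-! ### The distance function when the true solution satisfies the benchmark source condition. -/

section RegularCase

variable {H : Type*} [NormedAddCommGroup H] [InnerProductSpace ℝ H]
  {L : H →ₗ.[ℝ] H} {q : ℝ} {fbar fhat : H} {R : ℝ}

theorem distFun_eq_zero (h : fhat ∈ benchmarkSet L q fbar R) : distFun L q fbar fhat R = 0 := by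
  refine le_antisymm ?_ (Real.sInf_nonneg ?_)
  · refine csInf_le ⟨0, ?_⟩ ⟨fhat, h, by simp⟩
    rintro _ ⟨f, -, rfl⟩
    exact norm_nonneg _
  · rintro _ ⟨f, -, rfl⟩
    exact norm_nonneg _

theorem isDistMinimizer_iff (h : fhat ∈ benchmarkSet L q fbar R) (f : H) :
    IsDistMinimizer L q fbar fhat R f ↔ f = fhat := by
  rw [IsDistMinimizer, distFun_eq_zero h, norm_eq_zero, sub_eq_zero]
  exact ⟨fun hf => hf.2, fun hf => ⟨hf ▸ h, hf⟩⟩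

end RegularCase

end HilbertScale

/-! ### The convergence rate. -/

set_option maxHeartbeats 1000000 in
theorem mainTheorem2
    (p q s κ M Sig α Rbar ℓ ℓ₁ N₁ : ℝ)
    (hp : 0 ≤ p) (hq : 1 ≤ q) (hqp : q ≤ 2 + p) (hs : 0 < s) (hqs : q * (s - 1) < p + s)
    (hM : 0 < M) (hSig : 0 ≤ Sig) (hα : 0 < α) (hN₁ : 0 < N₁)
    (u : ℝ) (hu : u = (p + q) / (2 * (p + q) - 2 * s * (q - 1))) :
    (2 * u * (s + p) - p) / (2 * (p + 1)) = s * q / (2 * (p + q) - 2 * s * (q - 1)) ∧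
    -- the constant depends on nothing but the parameters above
    ∃ C : ℝ,
    ∀ (X : Type uX) [TopologicalSpace X] [PolishSpace X] [MeasurableSpace X] [BorelSpace X]
      (Y : Type uY) [NormedAddCommGroup Y] [InnerProductSpace ℝ Y] [CompleteSpace Y]
      [TopologicalSpace.SeparableSpace Y] [MeasurableSpace Y] [BorelSpace Y]
      (H : Type uH) [NormedAddCommGroup H] [InnerProductSpace ℝ H] [CompleteSpace H]
      [TopologicalSpace.SeparableSpace H]
      (H' : Type uK) [NormedAddCommGroup H'] [InnerProductSpace ℝ H'] [CompleteSpace H']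
      [TopologicalSpace.SeparableSpace H'] [RKHS ℝ H' X Y]
      (hK : HilbertScale.IsBoundedMeasurableKernel H' κ)
      -- the data distribution
      (ρ : Measure (X × Y)) [IsProbabilityMeasure ρ]
      -- the operator generating the Hilbert scale
      (L : H →ₗ.[ℝ] H) (ℓL : ℝ) (_ : HilbertScale.IsScaleGenerator L ℓL)
      -- the nonlinear forward operator `A : D → H'`, the true solution, the initial guess
      (D : Set H) (A : H → H') (fhat : H) (fbar : L.domain)
      (_ : HilbertScale.IsTrueSolution ρ D A fhat)
      (_ : HilbertScale.NoiseCondition ρ A fhat M Sig)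
      (_ : (fbar : H) ∈ D)
      (_ : Convex ℝ D) (_ : IsClosed D)
      (_ : HilbertScale.WeakSeqContinuousOn A D)
      -- conditional stability on `Q`
      (Q : Set H) (θ d : ℝ) (_ : 0 ≤ θ) (_ : 0 < d)
      (_ : Q ⊆ HilbertScale.scaleBall L θ fhat d ∩ D)
      (_ : ∀ f ∈ Q, HilbertScale.negNorm L p (f - fhat) ≤
        α * ‖HilbertScale.embL2 hK ρ.fst (A f - A fhat)‖ ^ s)
      -- Lipschitz continuity on a sufficiently large ball
      (ℓA d₀ : ℝ) (_ : 0 ≤ ℓA) (_ : Q ⊆ Metric.closedBall fhat d₀)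
      (_ : ∀ f ∈ Metric.closedBall fhat d₀ ∩ D, ∀ g ∈ Metric.closedBall fhat d₀ ∩ D,
        ‖A f - A g‖ ≤ ℓA * ‖f - g‖)
      -- the source condition
      (r Rdag : ℝ) (v : H) (_ : q ≤ r)
      (_ : fhat - fbar = HilbertScale.negPower L r v) (_ : ‖v‖ ≤ Rdag)
      -- the quantities through which `C` depends on the problem
      (_ : HilbertScale.negNorm L (r - q) v ≤ Rbar)
      (_ : ℓA / ℓL ≤ ℓ)
      (_ : ∀ f ∈ Q, ‖A f - A fhat‖ ≤ ℓ₁)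
      (_ : N₁ ≤ HilbertScale.effDim hK ρ.fst 1)
      -- the sample size and the regularization parameter
      (m : ℕ) (_ : 0 < m) (lam : ℝ) (_ : 0 < lam) (_ : lam ≤ 1)
      (_ : HilbertScale.effDim hK ρ.fst lam ≤ m * lam)
      (_ : HilbertScale.thetaFun hK ρ.fst u lam = 1 / √(m : ℝ)),
      -- the regular case: the distance function vanishes and its minimizing element is `fhat`
      HilbertScale.distFun L q fbar fhat Rbar = 0 ∧
      (∀ f, HilbertScale.IsDistMinimizer L q fbar fhat Rbar f ↔ f = fhat) ∧
      (∀ f, HilbertScale.IsDistMinimizer L q fbar fhat Rbar f →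
        ‖HilbertScale.embL2 hK ρ.fst (A f - A fhat)‖ = 0) ∧
      -- the error bounds
      ∀ η : ℝ, 0 < η → η < 1 →
        ∃ E : Set (Fin m → X × Y), MeasurableSet E ∧
          ENNReal.ofReal (1 - η) ≤ Measure.pi (fun _ : Fin m => ρ) E ∧
          ∀ z ∈ E, ∀ f : L.domain, HilbertScale.IsTikhonovMinimizer L D A fbar z lam f →
            (f : H) ∈ Q →
            ‖HilbertScale.embL2 hK ρ.fst (A f - A fhat)‖ ≤ C * lam ^ u * Real.log (4 / η) ∧
            ‖(f : H) - fhat‖ ≤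
              C * lam ^ (s * q / (2 * (p + q) - 2 * s * (q - 1))) *
                Real.log (4 / η) ^ max 1 ((p + s) / (p + 1)) := by
  refine ⟨HilbertScale.exponent_eq hp hqs hu, ?_⟩
  -- `c₁` and `c₂` bound the whitened noise and covariance deviations in units of `lam ^ u * log (4
  -- / η)`. `c₃` combines them in the energy inequality, and `c₄` results from solving that
  -- inequality. The second entry of the maximum below comes from the final interpolation.
  set a := (q - 1) / (p + 1) with ha
  set c₁ := 2 * ((κ + 1) * M / N₁ + Sig) with hc₁
  set c₂ := 2 * (2 * (κ + 1) ^ 2 / N₁ + κ) with hc₂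
  set c₃ := (1 + ℓ) * (2 * c₁ + c₂ * ℓ₁) with hc₃
  set c₄ := 2 * c₃ + (4 * Rbar * α ^ a) ^ ((p + 1) / (p + q - s * (q - 1))) with hc₄
  refine ⟨max c₄ (α ^ (1 / (p + 1)) * c₄ ^ ((p + s) / (p + 1))), ?_⟩
  intro X _ _ _ _ Y _ _ _ _ _ _ H _ _ _ _ H' _ _ _ _ _ hK ρ _ L ℓL hL D A fhat fbar hsol hnoise
    _ _ _ _ Q θ d _ _ hQ hstab ℓA d₀ hℓA hQd hLip r Rdag v hqr hsrc _ hv hℓ hℓ₁ hN₁le m hm lam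
    hlam hlam1 hNm hθ
  have hκ := hK.nonneg
  have hp1 : 0 < p + 1 := by linarith
  set w := HilbertScale.negPower L (r - q) v with hw
  have hwR : ‖w‖ ≤ Rbar := hv
  have hsrc' : fhat - fbar = HilbertScale.negPower L q w := by
    rw [hsrc, hw, ← HilbertScale.negPower_add hL (by linarith) (by linarith), add_sub_cancel]
  have hbench : fhat ∈ HilbertScale.benchmarkSet L q fbar Rbar := ⟨w, hsrc', hwR⟩
  refine ⟨HilbertScale.distFun_eq_zero hbench,
    fun f => HilbertScale.isDistMinimizer_iff hbench f, fun f hf => ?_, ?_⟩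
  · rw [(HilbertScale.isDistMinimizer_iff hbench f).1 hf, sub_self, map_zero, norm_zero]
  intro η hη0 hη1
  -- Monotonicity of the effective dimension carries the lower bound from `1` down to `lam ≤ 1`.
  have hNlam : N₁ ≤ HilbertScale.effDim hK ρ.fst lam :=
    hN₁le.trans (HilbertScale.effDim_anti hK ρ.fst hlam hlam1)
  set Λ := Real.log (4 / η) with hΛ
  have hΛ1 : 1 ≤ Λ := by
    rw [hΛ, Real.le_log_iff_exp_le (by positivity), le_div_iff₀ hη0]
    have := Real.exp_one_lt_d9
    nlinarith [Real.exp_pos 1]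
  have hR0 : 0 ≤ Rbar := (norm_nonneg _).trans hwR
  have hℓ0 : 0 ≤ ℓ := (div_nonneg hℓA hL.const_pos.le).trans hℓ
  have hc₁0 : 0 ≤ c₁ := by positivity
  have hc₂0 : 0 ≤ c₂ := by positivity
  obtain ⟨B, hBm, hB, hBz⟩ := HilbertScale.exists_covariance_event hK ρ hlam m hm hη0 hη1
  have hdev := HilbertScale.measure_noise_gt_le hK ρ hlam (A fhat) hM hsol.secondMoment hsol.condMean
    hnoise m hη0 hη1
  set B' : Set (Fin m → X × Y) := {z | 2 * ((κ + 1) * M / √lam +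
    √(m * (Sig ^ 2 * HilbertScale.effDim hK ρ.fst lam))) * Real.log (4 / η) <
      ‖∑ i, HilbertScale.whitenedKer hK ρ.fst lam (z i).1 ((z i).2 - A fhat (z i).1)‖} with hB'
  have hsc : SecondCountableTopology Y := UniformSpace.secondCountable_of_separable Y
  have hB'm : MeasurableSet B' :=
    measurableSet_lt measurable_const (HilbertScale.stronglyMeasurable_sum_pi
      (HilbertScale.stronglyMeasurable_whitenedKer hK ρ.fst hlam (Ω := X × Y) measurable_fst
        (measurable_snd.sub ((HilbertScale.measurable_apply hK (A fhat)).comp measurable_fst)))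
      m).norm.measurable
  refine ⟨(B ∪ B')ᶜ, (hBm.union hB'm).compl, ?_, ?_⟩
  · rw [prob_compl_eq_one_sub (hBm.union hB'm), ENNReal.ofReal_sub _ hη0.le, ENNReal.ofReal_one]
    refine tsub_le_tsub_left ((measure_union_le _ _).trans ((add_le_add hB hdev).trans_eq ?_)) _
    rw [← ENNReal.ofReal_add (by positivity) (by positivity), add_halves]
  intro z hz f hf hfQ
  have hzB : z ∉ B := fun h => hz (Or.inl h)
  have hzB' : z ∉ B' := fun h => hz (Or.inr h)
  obtain ⟨fh, hfh, hLfh⟩ := HilbertScale.exists_domain_of_source hL hq hsrc'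
  set g := A f - A fhat with hg
  set x := L (f - fh) with hx
  have hfx : (f : H) - fhat = ((f - fh : L.domain) : H) := by rw [Submodule.coe_sub, hfh]
  have hgℓ₁ : ‖g‖ ≤ ℓ₁ := hℓ₁ f hfQ
  have hℓ₁0 : 0 ≤ ℓ₁ := (norm_nonneg _).trans hgℓ₁
  have hfhatD : fhat ∈ D := interior_subset hsol.mem_interior
  have hgx : ‖g‖ ≤ ℓ * ‖x‖ := by
    have hd₀ : 0 ≤ d₀ := dist_nonneg.trans (Metric.mem_closedBall.1 (hQd hfQ))
    refine (hLip f ⟨hQd hfQ, hf.1⟩ fhat ⟨Metric.mem_closedBall_self hd₀, hfhatD⟩).trans ?_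
    rw [hfx]
    calc ℓA * ‖((f - fh : L.domain) : H)‖ ≤ ℓA * (‖x‖ / ℓL) := by
          gcongr
          rw [le_div_iff₀ hL.const_pos, mul_comm]
          exact hL.bound _
      _ = ℓA / ℓL * ‖x‖ := by ring
      _ ≤ ℓ * ‖x‖ := by gcongr
  have hbasic := HilbertScale.basic_inequality (fhat := fh) hf (by rw [hfh]; exact hfhatD)
  rw [hfh, ← hg, ← hx, hLfh] at hbasic
  have hδ₁ : ‖HilbertScale.whitening (HilbertScale.covOp hK ρ.fst) lam ((1 / (m : ℝ)) •
      ∑ i, RKHS.kerFun H' (z i).1 ((z i).2 - A fhat (z i).1))‖ ≤ c₁ * (lam ^ u * Λ) := by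
    rw [map_smul, map_sum, norm_smul, Real.norm_of_nonneg (by positivity)]
    exact (mul_le_mul_of_nonneg_left (not_lt.1 hzB') (by positivity)).trans
      (HilbertScale.deviation_le hN₁ hNlam hlam hm hNm hθ (by positivity) hSig (by linarith))
  have hδ₂ : ‖HilbertScale.whitening (HilbertScale.covOp hK ρ.fst) lam
      (HilbertScale.empCov H' z g - HilbertScale.covOp hK ρ.fst g)‖ ≤ c₂ * (lam ^ u * Λ) * ‖g‖ :=
    (hBz z hzB g).trans (mul_le_mul_of_nonneg_right
      (HilbertScale.deviation_le hN₁ hNlam hlam hm hNm hθ (by positivity) hκ (by linarith))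
      (norm_nonneg _))
  have henergy := HilbertScale.energy_le_of_deviation hK ρ.fst hlam hδ₁ hδ₂ (by positivity) hℓ0
    hgx hgℓ₁ (hbasic.trans_eq (sub_eq_add_neg _ _))
  set b := ‖HilbertScale.embL2 hK ρ.fst g‖ with hb
  set n := ‖HilbertScale.negPower L (p + 1) x‖ with hn
  have hnb : n ≤ α * b ^ s := by
    rw [hn, hx, ← HilbertScale.negNorm_eq hL hp, ← hfx]
    exact hstab f hfQ
  have hcross := HilbertScale.abs_inner_negPower_le hL hp hq hqp x w hwR
  have henergy' : b ^ 2 + lam * ‖x‖ ^ 2 ≤ c₃ * (lam ^ u * Λ) * √(b ^ 2 + lam * ‖x‖ ^ 2) +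
      2 * lam * (Rbar * (n ^ a * ‖x‖ ^ (1 - a))) := by
    refine henergy.trans (add_le_add (le_of_eq (by rw [hc₃]; ring)) ?_)
    rw [← mul_neg]
    exact mul_le_mul_of_nonneg_left ((neg_le_abs _).trans hcross) (by positivity)
  have hc₃0 : 0 ≤ c₃ := by positivity
  have hc₄0 : 0 ≤ c₄ := by positivity
  have hZ := HilbertScale.sqrt_energy_le hp hq hqp hs hqs hα hu (norm_nonneg _) (norm_nonneg x)
    (norm_nonneg _) hnb hlam hΛ1 hc₃0 hR0 henergy'
  have hlamu : 0 < lam ^ u := Real.rpow_pos_of_pos hlam u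
  have hΛ0 : 0 < Λ := by linarith
  constructor
  · have hbZ : b ≤ √(b ^ 2 + lam * ‖x‖ ^ 2) :=
      Real.le_sqrt_of_sq_le (by nlinarith [mul_nonneg hlam.le (sq_nonneg ‖x‖)])
    rw [mul_assoc]
    exact hbZ.trans (hZ.trans (mul_le_mul_of_nonneg_right (le_max_left _ _) (by positivity)))
  -- Interpolation at exponent `1` between `0` and `p + 1`, since `f - fhat = L⁻¹ x`.
  · have h1 := HilbertScale.norm_negPower_le hL zero_le_one hp1 (by linarith : (1 : ℝ) ≤ p + 1) x
    rw [hx, HilbertScale.negPower_one_apply hL, ← hfx, ← hx] at h1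
    have h2 := HilbertScale.interpolated_error_le hp hs hα (norm_nonneg _) (norm_nonneg x) (norm_nonneg _)
      hnb hlam hΛ1 hc₄0 hZ
    rw [HilbertScale.exponent_eq hp hqs hu] at h2
    refine h1.trans (h2.trans ?_)
    gcongr
    exact le_max_right _ _
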